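/- For $n\ge 1$ let $AD_n$ be the Aztec diamond of order $n$, i.e. the region of the square lattice obtained by stacking $2n$ horizontal strips of unit height and lengths $2,4,\dots,2n,2n,\dots,4,2$, centered on a common vertical lattice line. For $1\le i,j\le n$ let $AD_n^{i,j}$ be the region obtained from $AD_n$ by removing the $i$th unit square on its southwestern boundary and the $j$th unit square on its southeastern boundary, both counted from bottom to top (that is, the leftmost square of the $i$th strip and the rightmost square of the $j$th strip from the bottom). Let $M(R)$ be the number of domino tilings of a region $R$, and let the Delannoy number $D(k,l)$ be the number of lattice paths from $(0,0)$ to $(k,l)$ using only the steps $(1,0)$, $(0,1)$, $(1,1)$. Let $C$ be the circle inscribed in the unit square $[0,1]^2$. **Theorem.** Let $0<a,b<1$ and let $n,i,j\to\infty$ (along any sequence) so that $i/n\to a$ and $j/n\to b$. Then $$\lim\frac{M(AD_n^{i,j})}{M(AD_n)\,D(i-1,j-1)}=\begin{cases}1,&\text{if the segment }[(a,0),(0,b)]\text{ is outside }C,\\ 0,&\text{if the segment }[(a,0),(0,b)]\text{ crosses }C.\end{cases}$$ Here the segment is outside $C$ if all its points lie strictly outside $C$, and it crosses $C$ if it contains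 a point strictly inside $C$ (nothing is claimed when it is tangent to $C$). Moreover, the segment is outside $C$ if and only if $(1-a)(1-b)>1/2$. -/

import Mathlib

open Filter Topology

/-- A unit square (cell) of the square lattice; `(x, y)` stands for `[x, x+1] × [y, y+1]`. -/
abbrev Cell : Type := ℤ × ℤ

/-- A domino: the union of two unit squares that share an edge. -/
def IsDomino (d : Finset Cell) : Prop :=
  ∃ x y : ℤ, d = {(x, y), (x + 1, y)} ∨ d = {(x, y), (x, y + 1)}

/-- `T` is a domino tiling of the region `R`: a set of non-overlapping dominoes whose
union is `R`. -/
def IsDominoTiling (R : Finset Cell) (T : Finset (Finset Cell)) : Prop :=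
  (∀ d ∈ T, IsDomino d) ∧ (∀ d ∈ T, ∀ e ∈ T, d ≠ e → Disjoint d e) ∧ T.biUnion id = R

theorem finite_dominoTilings (R : Finset Cell) : {T | IsDominoTiling R T}.Finite := by
  refine (R.powerset.powerset.finite_toSet).subset ?_
  rintro T ⟨-, -, hR⟩
  rw [Finset.mem_coe, Finset.mem_powerset]
  intro d hd
  rw [Finset.mem_powerset, ← hR]
  exact Finset.subset_biUnion_of_mem id hd

/-- `M(R)`: the number of domino tilings of the region `R`. -/
noncomputable def numDominoTilings (R : Finset Cell) : ℕ :=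
  {T | IsDominoTiling R T}.ncard

/-- The Aztec diamond of order `n`: `2 n` centered horizontal strips of unit height, numbered
`r = 0, …, 2 n - 1` from bottom to top, of lengths `2, 4, …, 2 n, 2 n, …, 4, 2`; strip `r` has
half-length `h = min (r + 1) (2 n - r)` and the vertical line `x = 0` is the symmetry axis. -/
noncomputable def aztecDiamond (n : ℕ) : Finset Cell :=
  (Finset.range (2 * n)).biUnion fun r =>
    let h : ℕ := min (r + 1) (2 * n - r)
    (Finset.Ico (-(h : ℤ)) (h : ℤ)).image fun x => (x, (r : ℤ))

/-- The dented Aztec diamond: for `1 ≤ i, j ≤ n`, remove from the Aztec diamond of order `n` the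
`i`-th unit square on its southwestern boundary (the leftmost one of the `i`-th strip) and the
`j`-th unit square on its southeastern boundary (the rightmost one of the `j`-th strip), both
counted from bottom to top. -/
noncomputable def dentedAztecDiamond (n i j : ℕ) : Finset Cell :=
  aztecDiamond n \ {(-(i : ℤ), (i : ℤ) - 1), ((j : ℤ) - 1, (j : ℤ) - 1)}

/-- A Delannoy path from `(0, 0)` to `(k, l)` on `ℤ²`, given by its list of steps, each of which is
`(1, 0)`, `(0, 1)` or `(1, 1)`. -/
def IsDelannoyPath (k l : ℕ) (p : List (ℤ × ℤ)) : Prop :=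
  (∀ s ∈ p, s = (1, 0) ∨ s = (0, 1) ∨ s = (1, 1)) ∧ p.sum = ((k : ℤ), (l : ℤ))

theorem finite_delannoyPaths (k l : ℕ) : {p | IsDelannoyPath k l p}.Finite := by
  let S : Finset (ℤ × ℤ) := {(1, 0), (0, 1), (1, 1)}
  have key : ∀ p : List (ℤ × ℤ), (∀ s ∈ p, s = (1, 0) ∨ s = (0, 1) ∨ s = (1, 1)) →
      (p.length : ℤ) ≤ p.sum.1 + p.sum.2 := by
    intro p
    induction p with
    | nil => simp
    | cons s p ih =>
      intro h
      have h1 := ih fun t ht => h t (List.mem_cons_of_mem _ ht)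
      have h2 : 1 ≤ s.1 + s.2 := by
        rcases h s List.mem_cons_self with rfl | rfl | rfl <;> norm_num
      simp only [List.length_cons, List.sum_cons, Prod.fst_add, Prod.snd_add]
      push_cast
      linarith
  refine ((List.finite_length_le S (k + l)).image (List.map Subtype.val)).subset ?_
  rintro p ⟨h1, h2⟩
  have h3 := key p h1
  rw [h2] at h3
  refine ⟨p.pmap (fun s hs => (⟨s, hs⟩ : S)) fun s hs => ?_, ?_, ?_⟩
  · simpa [S] using h1 s hs
  · change (p.pmap _ _).length ≤ k + l
    rw [List.length_pmap]
    simp only at h3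
    exact_mod_cast h3
  · simp [List.map_pmap]

/-- The Delannoy number `D(k, l)`: the number of Delannoy paths from `(0, 0)` to `(k, l)`. -/
noncomputable def delannoy (k l : ℕ) : ℕ :=
  {p | IsDelannoyPath k l p}.ncard

/-- The segment `[(a, 0), (0, b)]` in the Euclidean plane. -/
def dentSegment (a b : ℝ) : Set (EuclideanSpace ℝ (Fin 2)) :=
  segment ℝ !₂[a, 0] !₂[0, b]

/-- The segment `[(a, 0), (0, b)]` is outside the circle inscribed in the unit square `[0, 1]²`
(the circle of center `(1/2, 1/2)` and radius `1/2`): all its points are exterior points. -/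
def SegmentOutsideCircle (a b : ℝ) : Prop :=
  ∀ p ∈ dentSegment a b, 1 / 2 < dist p !₂[1 / 2, 1 / 2]

/-- The segment `[(a, 0), (0, b)]` crosses the circle inscribed in the unit square `[0, 1]²`: it
has a point strictly inside the circle (a tangent segment does not cross). -/
def SegmentCrossesCircle (a b : ℝ) : Prop :=
  ∃ p ∈ dentSegment a b, dist p !₂[1 / 2, 1 / 2] < 1 / 2

/-! Write `D` for the `n × n` matrix of Delannoy numbers. Tilings of the Aztec diamond are counted
by `det (2 D)`, and removing the two boundary squares deletes one row and one column of `2 D`. The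
quotient of the two counts is therefore, up to sign, an entry of `(2 D)⁻¹`. Since `D = P diag(2^k)
Pᵀ` with `P` the Pascal matrix, that entry is explicit: with `p = i - 1` and `q = j - 1` its
absolute value is the partial sum over `k < n` of `t k = C(k,p) C(k,q) / 2^(k+1)`
(`numDominoTilings_dentedAztecDiamond`). The full series sums to `D(p,q)`
(`tsum_choose_mul_choose_div`), so the ratio in the theorem is the share of the series carried by `k
< n`.

Consecutive terms satisfy `t k / t (k+1) = 2 (1 - p/(k+1)) (1 - q/(k+1))`, which near `k = n` is
close to `2 (1-a) (1-b)`. If this exceeds `1`, the terms already decay geometrically from `(1-δ) n`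
on and the tail beyond `n` is negligible; if it is below `1`, they still grow up to `(1+δ) n` and
the head is negligible. The threshold `(1-a)(1-b) = 1/2` is the tangency condition for the segment
and the circle.

The determinant formula comes from covering the even cells one at a time, diagonal by diagonal. The
state is a set of rows, the ends of non-intersecting paths, and each step either keeps it or moves
one end to an adjacent row. A determinant of path weights obeys the same recursion by multilinearity
(`det_sweep_step`, `det_sweep_sink`), so no path bijection is needed. -/

/-! ### Geometry of the segment and the inscribed circle. -/

theorem dentSegment_point_dist_sq (a b t : ℝ) (p : EuclideanSpace ℝ (Fin 2))
    (hp : p = (1 - t) • !₂[a, 0] + t • !₂[0, b]) :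
    dist p !₂[1 / 2, 1 / 2] = √(((1 - t) * a - 1 / 2) ^ 2 + (t * b - 1 / 2) ^ 2) := by
  subst hp
  simp [EuclideanSpace.dist_eq, Real.dist_eq, sq_abs]

theorem mem_dentSegment_iff (a b : ℝ) (p : EuclideanSpace ℝ (Fin 2)) :
    p ∈ dentSegment a b ↔ ∃ t : ℝ, 0 ≤ t ∧ t ≤ 1 ∧ p = (1 - t) • !₂[a, 0] + t • !₂[0, b] := by
  constructor
  · rintro ⟨u, v, hu, hv, huv, rfl⟩
    exact ⟨v, hv, by linarith, by rw [show 1 - v = u by linarith]⟩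
  · rintro ⟨t, h0, h1, rfl⟩
    exact ⟨1 - t, t, by linarith, h0, by ring, rfl⟩

theorem half_lt_sqrt_iff (x : ℝ) : 1 / 2 < √x ↔ 1 / 4 < x := by
  rw [Real.lt_sqrt (by norm_num)]
  norm_num

theorem sqrt_lt_half_iff (x : ℝ) : √x < 1 / 2 ↔ x < 1 / 4 := by
  rw [Real.sqrt_lt' (by norm_num)]
  norm_num

/-- Completing the square in `t`: the sign of `(1-a)(1-b) - 1/2` decides whether the line through
the two points misses, touches or cuts the circle. -/
theorem dist_sq_line_identity (a b t : ℝ) :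
    4 * (a ^ 2 + b ^ 2) * (((1 - t) * a - 1 / 2) ^ 2 + (t * b - 1 / 2) ^ 2 - 1 / 4) =
      (2 * (a ^ 2 + b ^ 2) * t - (2 * a ^ 2 - a + b)) ^ 2
        + 4 * (a * b) * ((1 - a) * (1 - b) - 1 / 2) := by
  ring

theorem segmentOutsideCircle_iff (a b : ℝ) (ha0 : 0 < a) (ha1 : a < 1) (hb0 : 0 < b)
    (hb1 : b < 1) : SegmentOutsideCircle a b ↔ (1 - a) * (1 - b) > 1 / 2 := by
  have hab : 0 < a * b := mul_pos ha0 hb0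
  have hs : 0 < a ^ 2 + b ^ 2 := by positivity
  constructor
  · intro h
    by_contra! hle
    -- Places the foot `t` of the perpendicular from the centre inside the segment: this bound gives
    -- `0 ≤ t`, and with `a` and `b` exchanged it gives `t ≤ 1`. If it failed, then `x < 1/2` and
    -- `(1-x)(1-y) - 1/2 > (1-2x)(1/2 - x + x²) > 0`.
    have key : ∀ x y : ℝ, 0 < x → x < 1 → 0 < y → y < 1 → (1 - x) * (1 - y) ≤ 1 / 2 →
        0 ≤ 2 * x ^ 2 - x + y := by
      intro x y hx0 hx1 hy0 hy1 hxy
      by_contra! hneg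
      nlinarith [mul_pos hx0 hx0, mul_pos (sub_pos.2 hx1) (sub_pos.2 hneg), sq_nonneg (x - 1 / 2),
        mul_nonneg hx0.le (sq_nonneg (x - 1 / 2)), mul_pos hx0 hy0]
    have k1 := key a b ha0 ha1 hb0 hb1 hle
    have k2 := key b a hb0 hb1 ha0 ha1 (by linarith [mul_comm (1 - a) (1 - b)])
    set t := (2 * a ^ 2 - a + b) / (2 * (a ^ 2 + b ^ 2)) with ht
    have ht0 : 0 ≤ t := by positivity
    have ht1 : t ≤ 1 := by
      rw [ht, div_le_one (by positivity)]
      linarith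
    have hp := h _ ((mem_dentSegment_iff a b _).2 ⟨t, ht0, ht1, rfl⟩)
    rw [dentSegment_point_dist_sq a b t _ rfl, half_lt_sqrt_iff] at hp
    have e := dist_sq_line_identity a b t
    have e2 : 2 * (a ^ 2 + b ^ 2) * t - (2 * a ^ 2 - a + b) = 0 := by
      rw [ht]; field_simp; ring
    rw [e2] at e
    have h3 := mul_pos hs (sub_pos.2 hp)
    nlinarith [mul_nonneg hab.le (sub_nonneg.2 hle)]
  · intro h p hp
    obtain ⟨t, -, -, hp⟩ := (mem_dentSegment_iff a b p).1 hp
    rw [dentSegment_point_dist_sq a b t p hp, half_lt_sqrt_iff]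
    have e := dist_sq_line_identity a b t
    have h2 : 0 < 4 * (a * b) * ((1 - a) * (1 - b) - 1 / 2) := by
      have := sub_pos.2 h
      positivity
    have h3 : 0 < 4 * (a ^ 2 + b ^ 2) *
        (((1 - t) * a - 1 / 2) ^ 2 + (t * b - 1 / 2) ^ 2 - 1 / 4) := by
      rw [e]; positivity
    linarith [pos_of_mul_pos_right h3 (by positivity)]

theorem SegmentCrossesCircle.lt_half {a b : ℝ} (ha0 : 0 < a) (hb0 : 0 < b)
    (h : SegmentCrossesCircle a b) : (1 - a) * (1 - b) < 1 / 2 := by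
  obtain ⟨p, hp, hd⟩ := h
  obtain ⟨t, -, -, hp⟩ := (mem_dentSegment_iff a b p).1 hp
  rw [dentSegment_point_dist_sq a b t p hp, sqrt_lt_half_iff] at hd
  have hab : 0 < a * b := mul_pos ha0 hb0
  have hs : 0 < a ^ 2 + b ^ 2 := by positivity
  have e := dist_sq_line_identity a b t
  by_contra! hge
  have h1 := mul_pos hs (sub_pos.2 hd)
  have h2 := mul_nonneg hab.le (sub_nonneg.2 hge)
  nlinarith [sq_nonneg (2 * (a ^ 2 + b ^ 2) * t - (2 * a ^ 2 - a + b))]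

/-! ### Delannoy numbers: recurrence and explicit formula. -/

/-- The number of Delannoy paths with displacement `(x, y) ∈ ℤ²`. -/
noncomputable def intDelannoy (x y : ℤ) : ℕ :=
  {p : List (ℤ × ℤ) | (∀ s ∈ p, s = (1, 0) ∨ s = (0, 1) ∨ s = (1, 1)) ∧ p.sum = (x, y)}.ncard

theorem delannoy_eq_intDelannoy (k l : ℕ) : delannoy k l = intDelannoy k l := rfl

theorem sum_nonneg_of_delannoy_steps (p : List (ℤ × ℤ))
    (h : ∀ s ∈ p, s = (1, 0) ∨ s = (0, 1) ∨ s = (1, 1)) : 0 ≤ p.sum.1 ∧ 0 ≤ p.sum.2 := by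
  induction p with
  | nil => simp
  | cons s p ih =>
    have h1 := ih fun t ht => h t (List.mem_cons_of_mem _ ht)
    simp only [List.sum_cons, Prod.fst_add, Prod.snd_add]
    rcases h s List.mem_cons_self with rfl | rfl | rfl <;> constructor <;> simp <;> omega

theorem delannoyPaths_eq_empty {x y : ℤ} (h : x < 0 ∨ y < 0) :
    {p : List (ℤ × ℤ) | (∀ s ∈ p, s = (1, 0) ∨ s = (0, 1) ∨ s = (1, 1)) ∧ p.sum = (x, y)} = ∅ := by
  rw [Set.eq_empty_iff_forall_notMem]
  rintro p ⟨h1, h2⟩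
  have := sum_nonneg_of_delannoy_steps p h1
  rw [h2] at this
  simp only at this
  omega

theorem finite_intDelannoyPaths (x y : ℤ) :
    {p : List (ℤ × ℤ) | (∀ s ∈ p, s = (1, 0) ∨ s = (0, 1) ∨ s = (1, 1)) ∧
      p.sum = (x, y)}.Finite := by
  by_cases h : x < 0 ∨ y < 0
  · rw [delannoyPaths_eq_empty h]
    exact Set.finite_empty
  · push Not at h
    lift x to ℕ using h.1
    lift y to ℕ using h.2
    exact finite_delannoyPaths x y

theorem intDelannoy_of_neg {x y : ℤ} (h : x < 0 ∨ y < 0) : intDelannoy x y = 0 := by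
  rw [intDelannoy, delannoyPaths_eq_empty h, Set.ncard_empty]

theorem intDelannoy_zero_zero : intDelannoy 0 0 = 1 := by
  rw [intDelannoy, Set.ncard_eq_one]
  refine ⟨[], ?_⟩
  ext p
  simp only [Set.mem_ofPred_eq, Set.mem_singleton_iff]
  constructor
  · rintro ⟨h1, h2⟩
    cases p with
    | nil => rfl
    | cons s p =>
      exfalso
      have := sum_nonneg_of_delannoy_steps p fun t ht => h1 t (List.mem_cons_of_mem _ ht)
      rw [List.sum_cons, Prod.ext_iff] at h2
      simp only [Prod.fst_add, Prod.snd_add] at h2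
      rcases h1 s List.mem_cons_self with rfl | rfl | rfl <;> simp at h2 <;> omega
  · rintro rfl
    simp [Prod.zero_eq_mk]

/-- Splits by the first step. With integer arguments, the counts vanish at negative ones and the
origin is the only exception. -/
theorem intDelannoy_rec {x y : ℤ} (h : x ≠ 0 ∨ y ≠ 0) :
    intDelannoy x y = intDelannoy (x - 1) y + intDelannoy x (y - 1)
      + intDelannoy (x - 1) (y - 1) := by
  let P (x y : ℤ) : Set (List (ℤ × ℤ)) :=
    {p | (∀ s ∈ p, s = (1, 0) ∨ s = (0, 1) ∨ s = (1, 1)) ∧ p.sum = (x, y)}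
  have hP : P x y = (List.cons (1, 0) '' P (x - 1) y ∪ List.cons (0, 1) '' P x (y - 1))
      ∪ List.cons (1, 1) '' P (x - 1) (y - 1) := by
    ext p
    cases p with
    | nil =>
      simp only [P, Set.mem_ofPred_eq, Set.mem_union, Set.mem_image]
      simp [Prod.ext_iff]
      omega
    | cons s p =>
      simp only [P, Set.mem_ofPred_eq, Set.mem_union, Set.mem_image, List.cons.injEq,
        List.forall_mem_cons, List.sum_cons, Prod.ext_iff, Prod.fst_add, Prod.snd_add]
      constructor
      · rintro ⟨⟨h1, h2⟩, h3, h4⟩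
        rcases h1 with h1 | h1 | h1
        · exact Or.inl (Or.inl ⟨p, ⟨h2, by omega, by omega⟩, by omega, rfl⟩)
        · exact Or.inl (Or.inr ⟨p, ⟨h2, by omega, by omega⟩, by omega, rfl⟩)
        · exact Or.inr ⟨p, ⟨h2, by omega, by omega⟩, by omega, rfl⟩
      · rintro ((⟨q, ⟨h2, h3, h4⟩, h5, rfl⟩ | ⟨q, ⟨h2, h3, h4⟩, h5, rfl⟩) |
          ⟨q, ⟨h2, h3, h4⟩, h5, rfl⟩)
        all_goals exact ⟨⟨by omega, h2⟩, by omega, by omega⟩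
  have inj (s : ℤ × ℤ) : Function.Injective (List.cons s) := List.cons_injective
  have fin (s : ℤ × ℤ) (x y : ℤ) : (List.cons s '' P x y).Finite :=
    (finite_intDelannoyPaths x y).image _
  have card (s : ℤ × ℤ) (x y : ℤ) : (List.cons s '' P x y).ncard = intDelannoy x y :=
    Set.ncard_image_of_injective _ (inj s)
  have disj (s t : ℤ × ℤ) (hst : s ≠ t) (A B : Set (List (ℤ × ℤ))) :
      Disjoint (List.cons s '' A) (List.cons t '' B) := by
    rw [Set.disjoint_left]
    rintro _ ⟨p, -, rfl⟩ ⟨q, -, hq⟩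
    exact hst (List.cons.inj hq).1.symm
  change (P x y).ncard = _
  rw [hP, Set.ncard_union_eq
      (Disjoint.union_left (disj _ _ (by simp) _ _) (disj _ _ (by simp) _ _))
      ((fin _ _ _).union (fin _ _ _)) (fin _ _ _),
    Set.ncard_union_eq (disj _ _ (by simp) _ _) (fin _ _ _) (fin _ _ _), card, card, card]

theorem delannoy_zero_left (l : ℕ) : delannoy 0 l = 1 := by
  induction l with
  | zero => exact intDelannoy_zero_zero
  | succ l ih =>
    rw [delannoy_eq_intDelannoy] at ih ⊢
    rw [intDelannoy_rec (by simp; omega), intDelannoy_of_neg (by simp),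
      intDelannoy_of_neg (x := ((0 : ℕ) : ℤ) - 1) (by simp)]
    push_cast at ih ⊢
    simpa using ih

theorem delannoy_zero_right (k : ℕ) : delannoy k 0 = 1 := by
  induction k with
  | zero => exact intDelannoy_zero_zero
  | succ k ih =>
    rw [delannoy_eq_intDelannoy] at ih ⊢
    rw [intDelannoy_rec (by simp; omega), intDelannoy_of_neg (y := ((0 : ℕ) : ℤ) - 1) (by simp),
      intDelannoy_of_neg (y := ((0 : ℕ) : ℤ) - 1) (by simp)]
    push_cast at ih ⊢
    simpa using ih

theorem delannoy_succ_succ (k l : ℕ) :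
    delannoy (k + 1) (l + 1) = delannoy k (l + 1) + delannoy (k + 1) l + delannoy k l := by
  simp only [delannoy_eq_intDelannoy]
  rw [intDelannoy_rec (by simp; omega)]
  push_cast
  simp

/-- Pascal's rule in both factors. The middle sum on the right is the difference of the explicit
formulas for `(p + 1, q)` and `(p, q)`, which turns the identity into the Delannoy recurrence. -/
theorem sum_choose_mul_choose_mul_two_pow_aux (N p q : ℕ) :
    ∑ k ∈ Finset.range N, (p + 1).choose (k + 1) * (q + 1).choose (k + 1) * 2 ^ (k + 1) =
      ∑ k ∈ Finset.range N, (p.choose (k + 1) * (q + 1).choose (k + 1) * 2 ^ (k + 1)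
        + p.choose k * q.choose (k + 1) * 2 ^ (k + 1)
        + 2 * (p.choose k * q.choose k * 2 ^ k)) := by
  refine Finset.sum_congr rfl fun k _ => ?_
  simp only [Nat.choose_succ_succ']
  ring

/-- The explicit formula for the Delannoy numbers, with an arbitrary long enough range. -/
theorem sum_choose_mul_choose_mul_two_pow (p q N : ℕ) (hN : min p q < N) :
    ∑ k ∈ Finset.range N, p.choose k * q.choose k * 2 ^ k = delannoy p q := by
  induction p generalizing q N with
  | zero =>
    obtain ⟨N, rfl⟩ : ∃ M, N = M + 1 := ⟨N - 1, by omega⟩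
    rw [Finset.sum_range_succ']
    simp [delannoy_zero_left]
  | succ p ihp =>
    induction q generalizing N with
    | zero =>
      obtain ⟨N, rfl⟩ : ∃ M, N = M + 1 := ⟨N - 1, by omega⟩
      rw [Finset.sum_range_succ']
      simp [delannoy_zero_right]
    | succ q ihq =>
      obtain ⟨N, rfl⟩ : ∃ M, N = M + 1 := ⟨N - 1, by omega⟩
      have h1 := ihp (q + 1) (N + 1) (by omega)
      have h2 := ihq (N + 1) (by omega)
      have h3 := ihp q (N + 1) (by omega)
      have h4 := ihp q N (by omega)
      rw [delannoy_succ_succ, ← h2]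
      rw [Finset.sum_range_succ'] at h1 h3 ⊢
      rw [Finset.sum_range_succ' _ N]
      rw [sum_choose_mul_choose_mul_two_pow_aux]
      simp only [Finset.sum_add_distrib, ← Finset.mul_sum]
      simp only [Nat.choose_succ_succ' p, add_mul, Finset.sum_add_distrib]
      simp only [Nat.choose_zero_right] at h1 h3 ⊢
      omega

/-! ### Tilings conditioned on one domino. -/

/-- The four cells that share an edge with `v`. -/
def cellNeighbors (v : Cell) : Finset Cell :=
  {(v.1 + 1, v.2), (v.1 - 1, v.2), (v.1, v.2 + 1), (v.1, v.2 - 1)}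

theorem mem_cellNeighbors {u v : Cell} : u ∈ cellNeighbors v ↔
    u = (v.1 + 1, v.2) ∨ u = (v.1 - 1, v.2) ∨ u = (v.1, v.2 + 1) ∨ u = (v.1, v.2 - 1) := by
  simp [cellNeighbors]

theorem isDomino_pair {u v : Cell} (h : u ∈ cellNeighbors v) : IsDomino {v, u} := by
  obtain ⟨x, y⟩ := v
  rw [mem_cellNeighbors] at h
  rcases h with rfl | rfl | rfl | rfl
  · exact ⟨x, y, Or.inl rfl⟩
  · exact ⟨x - 1, y, Or.inl (by rw [Finset.pair_comm]; simp)⟩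
  · exact ⟨x, y, Or.inr rfl⟩
  · exact ⟨x, y - 1, Or.inr (by rw [Finset.pair_comm]; simp)⟩

theorem IsDomino.exists_eq_pair {d : Finset Cell} (hd : IsDomino d) {v : Cell} (hv : v ∈ d) :
    ∃ u ∈ cellNeighbors v, d = {v, u} := by
  obtain ⟨x, y, rfl | rfl⟩ := hd <;> simp only [Finset.mem_insert, Finset.mem_singleton] at hv <;>
    rcases hv with rfl | rfl
  · exact ⟨(x + 1, y), by simp [mem_cellNeighbors], rfl⟩
  · exact ⟨(x, y), by simp [mem_cellNeighbors], Finset.pair_comm _ _⟩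
  · exact ⟨(x, y + 1), by simp [mem_cellNeighbors], rfl⟩
  · exact ⟨(x, y), by simp [mem_cellNeighbors], Finset.pair_comm _ _⟩

theorem IsDominoTiling.subset {R : Finset Cell} {T : Finset (Finset Cell)}
    (hT : IsDominoTiling R T) {d : Finset Cell} (hd : d ∈ T) : d ⊆ R := by
  rw [← hT.2.2]
  exact Finset.subset_biUnion_of_mem id hd

theorem IsDominoTiling.insert {R : Finset Cell} {T : Finset (Finset Cell)} {d : Finset Cell}
    (hT : IsDominoTiling (R \ d) T) (hd : IsDomino d) (hdR : d ⊆ R) :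
    IsDominoTiling R (insert d T) := by
  have hdisj : ∀ e ∈ T, Disjoint d e := fun e he =>
    Finset.disjoint_of_subset_right (hT.subset he) Finset.disjoint_sdiff
  refine ⟨?_, ?_, ?_⟩
  · intro e he
    rcases Finset.mem_insert.1 he with rfl | he
    · exact hd
    · exact hT.1 e he
  · intro e he f hf hef
    rcases Finset.mem_insert.1 he with he' | he' <;>
      rcases Finset.mem_insert.1 hf with hf' | hf'
    · exact absurd (he'.trans hf'.symm) hef
    · exact he' ▸ hdisj f hf'
    · exact hf' ▸ (hdisj e he').symm
    · exact hT.2.1 e he' f hf' hef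
  · rw [Finset.biUnion_insert, hT.2.2]
    exact Finset.union_sdiff_of_subset hdR

theorem IsDominoTiling.erase {R : Finset Cell} {T : Finset (Finset Cell)} {d : Finset Cell}
    (hT : IsDominoTiling R T) (hd : d ∈ T) : IsDominoTiling (R \ d) (T.erase d) := by
  refine ⟨fun e he => hT.1 e (Finset.mem_of_mem_erase he), fun e he f hf hef =>
    hT.2.1 e (Finset.mem_of_mem_erase he) f (Finset.mem_of_mem_erase hf) hef, ?_⟩
  rw [← hT.2.2]
  ext c
  simp only [Finset.mem_biUnion, Finset.mem_erase, id, Finset.mem_sdiff]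
  constructor
  · rintro ⟨e, ⟨hne, he⟩, hc⟩
    exact ⟨⟨e, he, hc⟩, fun hcd => Finset.disjoint_left.1 (hT.2.1 e he d hd hne) hc hcd⟩
  · rintro ⟨⟨e, he, hc⟩, hcd⟩
    exact ⟨e, ⟨fun h => hcd (h ▸ hc), he⟩, hc⟩

/-- Conditioning on the domino that covers the cell `v`. -/
theorem numDominoTilings_eq_sum (R : Finset Cell) (v : Cell) (hv : v ∈ R) :
    numDominoTilings R =
      ∑ u ∈ (cellNeighbors v).filter (· ∈ R), numDominoTilings (R \ {v, u}) := by
  classical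
  simp only [numDominoTilings, Set.ncard_eq_toFinset_card _ (finite_dominoTilings _)]
  have hnot : ∀ u (T : Finset (Finset Cell)), IsDominoTiling (R \ {v, u}) T → ∀ d ∈ T, v ∉ d :=
    fun u T hT d hd hvd => by simpa using hT.subset hd hvd
  have key : (finite_dominoTilings R).toFinset =
      ((cellNeighbors v).filter (· ∈ R)).biUnion fun u =>
        (finite_dominoTilings (R \ {v, u})).toFinset.image (insert {v, u}) := by
    ext T
    simp only [Set.Finite.mem_toFinset, Set.mem_ofPred_eq, Finset.mem_biUnion, Finset.mem_filter,
      Finset.mem_image]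
    constructor
    · intro hT
      have hv' := hv
      rw [← hT.2.2, Finset.mem_biUnion] at hv'
      obtain ⟨d, hd, hvd⟩ := hv'
      obtain ⟨u, hu, rfl⟩ := (hT.1 d hd).exists_eq_pair hvd
      exact ⟨u, ⟨hu, hT.subset hd (by simp)⟩, _, hT.erase hd, Finset.insert_erase hd⟩
    · rintro ⟨u, ⟨hu, huR⟩, T', hT', rfl⟩
      refine hT'.insert (isDomino_pair hu) ?_
      rw [Finset.insert_subset_iff, Finset.singleton_subset_iff]
      exact ⟨hv, huR⟩
  rw [key, Finset.card_biUnion]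
  · refine Finset.sum_congr rfl fun u _ => Finset.card_image_of_injOn ?_
    intro T hT T' hT' h
    simp only [Set.Finite.coe_toFinset, Set.mem_ofPred_eq] at hT hT'
    have h1 : ({v, u} : Finset Cell) ∉ T := fun h => hnot u T hT _ h (by simp)
    have h2 : ({v, u} : Finset Cell) ∉ T' := fun h => hnot u T' hT' _ h (by simp)
    rw [← Finset.erase_insert h1, ← Finset.erase_insert h2]
    exact congrArg (fun S => Finset.erase S _) h
  · intro u hu u' hu' huu'
    rw [Function.onFun, Finset.disjoint_left]
    intro T hT hT'
    simp only [Finset.mem_image, Set.Finite.mem_toFinset, Set.mem_ofPred_eq] at hT hT'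
    obtain ⟨S, hS, rfl⟩ := hT
    obtain ⟨S', hS', h⟩ := hT'
    have h1 : ({v, u} : Finset Cell) ∈ insert {v, u'} S' := h ▸ Finset.mem_insert_self _ _
    rcases Finset.mem_insert.1 h1 with h1 | h1
    · have h2 : u ∈ ({v, u'} : Finset Cell) := h1 ▸ (by simp)
      have h3 : u' ∈ ({v, u} : Finset Cell) := h1 ▸ (by simp)
      simp only [Finset.mem_insert, Finset.mem_singleton] at h2 h3
      rcases h2 with h2 | h2
      · rcases h3 with h3 | h3
        · exact huu' (h2.trans h3.symm)
        · exact huu' h3.symm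
      · exact huu' h2
    · exact hnot u' S' hS' _ h1 (by simp)

theorem numDominoTilings_empty : numDominoTilings ∅ = 1 := by
  rw [numDominoTilings, Set.ncard_eq_one]
  refine ⟨∅, ?_⟩
  ext T
  simp only [Set.mem_ofPred_eq, Set.mem_singleton_iff]
  constructor
  · intro hT
    refine Finset.eq_empty_of_forall_notMem fun d hd => ?_
    obtain ⟨x, y, h⟩ := hT.1 d hd
    have := hT.subset hd
    rcases h with rfl | rfl <;> simp at this
  · rintro rfl
    exact ⟨by simp, by simp, by simp⟩

/-! ### The inverse of the Delannoy matrix and its minors. -/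

/-- The sum is the `a`-th finite difference at `0` of `k ↦ C(k,b)`, and each difference lowers `b`
by one. -/
theorem sum_alternating_choose_mul_choose (N a b : ℕ) (ha : a < N) :
    ∑ k ∈ Finset.range N, (-1 : ℝ) ^ (a + k) * a.choose k * k.choose b = if a = b then 1 else 0 := by
  induction a generalizing N b with
  | zero =>
    obtain ⟨N, rfl⟩ : ∃ M, N = M + 1 := ⟨N - 1, by omega⟩
    rw [Finset.sum_range_succ']
    cases b <;> simp
  | succ a ih =>
    obtain ⟨N, rfl⟩ : ∃ M, N = M + 1 := ⟨N - 1, by omega⟩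
    have h1 := ih (N + 1) b (by omega)
    rw [Finset.sum_range_succ'] at h1 ⊢
    have e1 : ∀ k, (-1 : ℝ) ^ (a + 1 + (k + 1)) * ((a + 1).choose (k + 1) : ℕ) * (k + 1).choose b =
        (-1 : ℝ) ^ (a + k) * a.choose k * (k + 1).choose b
          - (-1 : ℝ) ^ (a + (k + 1)) * a.choose (k + 1) * (k + 1).choose b := by
      intro k
      rw [Nat.choose_succ_succ']
      push_cast
      ring
    simp only [e1, Finset.sum_sub_distrib]
    cases b with
    | zero =>
      have h2 := ih N 0 (by omega)
      simp only [Nat.choose_zero_right, Nat.cast_one, mul_one, add_zero] at h1 h2 ⊢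
      rw [h2, pow_succ]
      simp
      linarith
    | succ b =>
      have h2 := ih N b (by omega)
      have h3 := ih N (b + 1) (by omega)
      simp only [Nat.choose_succ_succ' _ b, Nat.cast_add, mul_add, Finset.sum_add_distrib] at *
      simp only [Nat.choose_zero_succ, Nat.cast_zero, mul_zero, add_zero, add_left_inj] at *
      linarith

/-- The matrix of the first `n × n` Delannoy numbers. -/
noncomputable def delannoyMatrix (n : ℕ) : Matrix (Fin n) (Fin n) ℝ :=
  Matrix.of fun p q => (delannoy p q : ℝ)

/-- The lower triangular Pascal matrix. -/
noncomputable def pascalMatrix (n : ℕ) : Matrix (Fin n) (Fin n) ℝ :=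
  Matrix.of fun p k => ((p : ℕ).choose k : ℝ)

/-- The inverse of the lower triangular Pascal matrix. -/
noncomputable def signedPascalMatrix (n : ℕ) : Matrix (Fin n) (Fin n) ℝ :=
  Matrix.of fun p k => (-1 : ℝ) ^ ((p : ℕ) + k) * ((p : ℕ).choose k : ℝ)

theorem signedPascalMatrix_mul_pascalMatrix (n : ℕ) :
    signedPascalMatrix n * pascalMatrix n = 1 := by
  ext a b
  simp only [Matrix.mul_apply, signedPascalMatrix, pascalMatrix, Matrix.of_apply, Matrix.one_apply]
  rw [Fin.sum_univ_eq_sum_range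
    (fun k => (-1 : ℝ) ^ ((a : ℕ) + k) * (a : ℕ).choose k * k.choose b) n,
    sum_alternating_choose_mul_choose n a b a.2]
  simp [Fin.ext_iff]

theorem delannoyMatrix_eq (n : ℕ) : delannoyMatrix n =
    pascalMatrix n * Matrix.diagonal (fun k : Fin n => (2 : ℝ) ^ (k : ℕ)) *
      (pascalMatrix n).transpose := by
  ext p q
  rw [Matrix.mul_apply]
  simp only [Matrix.mul_diagonal, pascalMatrix, delannoyMatrix, Matrix.of_apply,
    Matrix.transpose_apply]
  rw [Fin.sum_univ_eq_sum_range
    (fun k => ((p : ℕ).choose k : ℝ) * 2 ^ k * (q : ℕ).choose k) n,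
    ← sum_choose_mul_choose_mul_two_pow p q n (lt_of_le_of_lt (min_le_left _ _) p.2)]
  push_cast
  exact Finset.sum_congr rfl fun k _ => by ring

/-- The inverse of the Delannoy matrix. -/
noncomputable def delannoyInverse (n : ℕ) : Matrix (Fin n) (Fin n) ℝ :=
  (signedPascalMatrix n).transpose * Matrix.diagonal (fun k : Fin n => ((2 : ℝ) ^ (k : ℕ))⁻¹) *
    signedPascalMatrix n

theorem delannoyMatrix_mul_delannoyInverse (n : ℕ) :
    delannoyMatrix n * delannoyInverse n = 1 := by
  have h1 := signedPascalMatrix_mul_pascalMatrix n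
  have h2 : pascalMatrix n * signedPascalMatrix n = 1 := mul_eq_one_comm.1 h1
  have h3 : (pascalMatrix n).transpose * (signedPascalMatrix n).transpose = 1 := by
    rw [← Matrix.transpose_mul, h1, Matrix.transpose_one]
  have h4 : Matrix.diagonal (fun k : Fin n => (2 : ℝ) ^ (k : ℕ)) *
      Matrix.diagonal (fun k : Fin n => ((2 : ℝ) ^ (k : ℕ))⁻¹) = 1 := by
    rw [Matrix.diagonal_mul_diagonal]
    simp
  rw [delannoyMatrix_eq, delannoyInverse]
  calc _ = pascalMatrix n * (Matrix.diagonal (fun k : Fin n => (2 : ℝ) ^ (k : ℕ)) *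
        (((pascalMatrix n).transpose * (signedPascalMatrix n).transpose) *
        Matrix.diagonal (fun k : Fin n => ((2 : ℝ) ^ (k : ℕ))⁻¹))) * signedPascalMatrix n := by
        simp only [Matrix.mul_assoc]
    _ = 1 := by rw [h3, Matrix.one_mul, h4, Matrix.mul_one, h2]

/-- Every summand of the entry carries the same sign `(-1)^(p+q)`, so nothing cancels. -/
theorem abs_delannoyInverse_apply (n : ℕ) (p q : Fin n) : |delannoyInverse n p q| =
    ∑ k ∈ Finset.range n, (k.choose p : ℝ) * k.choose q / 2 ^ k := by
  have h : delannoyInverse n p q = (-1 : ℝ) ^ ((p : ℕ) + q) *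
      ∑ k ∈ Finset.range n, (k.choose p : ℝ) * k.choose q / 2 ^ k := by
    rw [delannoyInverse, Matrix.mul_apply]
    simp only [Matrix.mul_diagonal, signedPascalMatrix, Matrix.of_apply, Matrix.transpose_apply]
    rw [← Fin.sum_univ_eq_sum_range (fun k => (k.choose p : ℝ) * k.choose q / 2 ^ k) n,
      Finset.mul_sum]
    refine Finset.sum_congr rfl fun k _ => ?_
    have : (-1 : ℝ) ^ ((k : ℕ) + p) * (-1 : ℝ) ^ ((k : ℕ) + q) = (-1) ^ ((p : ℕ) + q) := by
      rw [← pow_add, show (k : ℕ) + p + (k + q) = 2 * k + (p + q) by ring, pow_add, pow_mul]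
      simp
    rw [← this]
    field_simp
  rw [h, abs_mul, abs_pow, abs_neg, abs_one, one_pow, one_mul, abs_of_nonneg]
  positivity

/-- The minors of twice the Delannoy matrix, relative to its determinant. -/
theorem abs_det_minor_two_smul_delannoyMatrix (m : ℕ) (p q : Fin (m + 1)) :
    |(((2 : ℝ) • delannoyMatrix (m + 1)).submatrix p.succAbove q.succAbove).det| =
      |((2 : ℝ) • delannoyMatrix (m + 1)).det| *
        ∑ k ∈ Finset.range (m + 1), (k.choose p : ℝ) * k.choose q / 2 ^ (k + 1) := by
  set A := (2 : ℝ) • delannoyMatrix (m + 1) with hA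
  set B := (2⁻¹ : ℝ) • delannoyInverse (m + 1) with hB
  have hAB : A * B = 1 := by
    rw [hA, hB, Matrix.smul_mul, Matrix.mul_smul, delannoyMatrix_mul_delannoyInverse, smul_smul]
    norm_num
  have hadj : A.adjugate = A.det • B := by
    calc A.adjugate = A.adjugate * (A * B) := by rw [hAB, Matrix.mul_one]
      _ = A.det • B := by
        rw [← Matrix.mul_assoc, Matrix.adjugate_mul, Matrix.smul_mul, Matrix.one_mul]
  have h1 := congrFun (congrFun hadj q) p
  rw [Matrix.adjugate_fin_succ_eq_det_submatrix, Matrix.smul_apply, smul_eq_mul, hB,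
    Matrix.smul_apply, smul_eq_mul] at h1
  have h2 := congrArg abs h1
  rw [abs_mul, abs_pow, abs_neg, abs_one, one_pow, one_mul, abs_mul, abs_mul,
    abs_delannoyInverse_apply] at h2
  rw [h2, abs_of_pos (by norm_num : (0 : ℝ) < 2⁻¹), Finset.mul_sum]
  congr 1
  refine Finset.sum_congr rfl fun k _ => ?_
  rw [pow_succ]
  field_simp

/-! ### The sweep of the Aztec diamond. -/

theorem numDominoTilings_eq_add (R : Finset Cell) (x y : ℤ) (hv : (x, y) ∈ R) :
    numDominoTilings R =
      (if (x + 1, y) ∈ R then numDominoTilings (R \ {(x, y), (x + 1, y)}) else 0) +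
      (if (x - 1, y) ∈ R then numDominoTilings (R \ {(x, y), (x - 1, y)}) else 0) +
      (if (x, y + 1) ∈ R then numDominoTilings (R \ {(x, y), (x, y + 1)}) else 0) +
      (if (x, y - 1) ∈ R then numDominoTilings (R \ {(x, y), (x, y - 1)}) else 0) := by
  rw [numDominoTilings_eq_sum R (x, y) hv, Finset.sum_filter, cellNeighbors,
    Finset.sum_insert (by simp [Prod.ext_iff]; omega), Finset.sum_insert (by simp [Prod.ext_iff]),
    Finset.sum_insert (by simp [Prod.ext_iff]; omega), Finset.sum_singleton]
  ring

/-- Membership in the part of the Aztec diamond of order `n` that is left when the even cells are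
swept in the order of increasing `x + y` and, for equal `x + y`, of decreasing `y - x`, and the
next one to be processed has `x + y = 2 c`, `y - x = 2 d`. The set `S` consists of the rows that
contain an odd cell which is still uncovered although the even cell to its left is processed;
`E` is the set of rows of the even cells on the southeastern boundary that belong to the region. -/
def SweepCell (n : ℕ) (c d : ℤ) (S E : Set ℤ) (x y : ℤ) : Prop :=
  ((x + y) % 2 = 0 ∧ x + y ≤ 2 * n - 2 ∧ 0 ≤ y - x ∧ y - x ≤ 2 * n ∧
    (2 * c < x + y ∨ (x + y = 2 * c ∧ y - x ≤ 2 * d)) ∧ (y = x → y ∈ E)) ∨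
  ((x + y) % 2 = 1 ∧ x + y ≤ 2 * n - 1 ∧ 1 ≤ y - x ∧ y - x ≤ 2 * n - 1 ∧
    (2 * c + 3 ≤ x + y ∨ (x + y = 2 * c + 1 ∧ y - x < 2 * d + 1) ∨
      (x + y = 2 * c + 1 ∧ 2 * d + 1 ≤ y - x ∧ y ∈ S) ∨
      (x + y = 2 * c - 1 ∧ y - x ≤ 2 * d + 1 ∧ y ∈ S)))

open Classical in
/-- The part of the Aztec diamond described by `SweepCell`. -/
noncomputable def sweepRegion (n : ℕ) (c d : ℤ) (S E : Set ℤ) : Finset Cell :=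
  (Finset.Icc (-(n : ℤ)) n ×ˢ Finset.Icc 0 (2 * (n : ℤ))).filter
    fun p => SweepCell n c d S E p.1 p.2

theorem mem_sweepRegion {n : ℕ} {c d : ℤ} (hc : 0 ≤ c) {S E : Set ℤ} {x y : ℤ} :
    (x, y) ∈ sweepRegion n c d S E ↔ SweepCell n c d S E x y := by
  simp only [sweepRegion, Finset.mem_filter, Finset.mem_product, Finset.mem_Icc,
    and_iff_right_iff_imp]
  intro h
  unfold SweepCell at h
  omega

section Steps

variable {n : ℕ} {c d : ℤ} {S E : Set ℤ}

/-- The odd cell left of the current even cell `(c - d, c + d)` has no other neighbour left, so the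
domino is forced. The odd cell on the right then takes its place, and `S` does not change. -/
theorem sweep_step_of_mem (hc : 0 ≤ c) (hcn : c < n) (hd : 1 ≤ d) (hdn : d < n)
    (hS : c + d ∈ S) : numDominoTilings (sweepRegion n c d S E) =
      numDominoTilings (sweepRegion n c (d - 1) S E) := by
  have e : c - d - 1 + 1 = c - d := by ring
  rw [numDominoTilings_eq_add _ (c - d - 1) (c + d), if_pos, if_neg, if_neg, if_neg, e,
    add_zero, add_zero, add_zero]
  · congr 1
    ext ⟨x, y⟩
    simp only [Finset.mem_sdiff, Finset.mem_insert, Finset.mem_singleton, mem_sweepRegion hc,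
      Prod.mk.injEq]
    unfold SweepCell
    by_cases hy : y = c + d
    · subst hy
      simp only [hS]
      grind (splits := 40)
    · grind (splits := 40)
  all_goals
    rw [mem_sweepRegion hc]
    unfold SweepCell
    grind (splits := 40)

/-- The current even cell is covered towards the right, upwards or downwards. The last two choices
use up the odd cell of an adjacent row of `S` and leave the one on the right uncovered: a path end
moves to row `c + d`. -/
theorem sweep_step_of_notMem (hc : 0 ≤ c) (hcn : c < n) (hd : 1 ≤ d) (hdn : d ≤ n)
    (hS : c + d ∉ S) (hSn : ∀ y ∈ S, y ≤ c + n) [Decidable (c + d + 1 ∈ S)]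
    [Decidable (c + d - 1 ∈ S)] :
    numDominoTilings (sweepRegion n c d S E) =
      numDominoTilings (sweepRegion n c (d - 1) S E) +
      (if c + d + 1 ∈ S then
        numDominoTilings (sweepRegion n c (d - 1) (insert (c + d) (S \ {c + d + 1})) E) else 0) +
      (if c + d - 1 ∈ S then
        numDominoTilings (sweepRegion n c (d - 1) (insert (c + d) (S \ {c + d - 1})) E)
        else 0) := by
  rw [numDominoTilings_eq_add _ (c - d) (c + d), if_pos, if_neg, add_zero]
  · refine congrArg₂ _ (congrArg₂ _ ?_ ?_) ?_
    · congr 1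
      ext ⟨x, y⟩
      simp only [Finset.mem_sdiff, Finset.mem_insert, Finset.mem_singleton, mem_sweepRegion hc,
        Prod.mk.injEq]
      unfold SweepCell
      grind (splits := 40)
    · have h1 : (c - d, c + d + 1) ∈ sweepRegion n c d S E ↔ c + d + 1 ∈ S := by
        rw [mem_sweepRegion hc]
        unfold SweepCell
        grind (splits := 40)
      simp only [h1]
      split_ifs
      · congr 1
        ext ⟨x, y⟩
        simp only [Finset.mem_sdiff, Finset.mem_insert, Finset.mem_singleton, mem_sweepRegion hc,
          Prod.mk.injEq]
        unfold SweepCell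
        simp only [Set.mem_insert_iff, Set.mem_sdiff, Set.mem_singleton_iff]
        grind (splits := 40)
      · rfl
    · have h1 : (c - d, c + d - 1) ∈ sweepRegion n c d S E ↔ c + d - 1 ∈ S := by
        rw [mem_sweepRegion hc]
        unfold SweepCell
        grind (splits := 40)
      simp only [h1]
      split_ifs
      · congr 1
        ext ⟨x, y⟩
        simp only [Finset.mem_sdiff, Finset.mem_insert, Finset.mem_singleton, mem_sweepRegion hc,
          Prod.mk.injEq]
        unfold SweepCell
        simp only [Set.mem_insert_iff, Set.mem_sdiff, Set.mem_singleton_iff]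
        grind (splits := 40)
      · rfl
  all_goals
    rw [mem_sweepRegion hc]
    unfold SweepCell
    grind (splits := 40)

/-- On the southeastern boundary the even cell has no neighbour to the right or below, so it absorbs
a path ending in row `c` or `c + 1`. At a dent nothing can be absorbed. -/
theorem sweep_sink_of_mem (hc : 0 ≤ c) (hcn : c < n) (hE : c ∈ E) (hS : c ∈ S) :
    numDominoTilings (sweepRegion n c 0 S E) =
      numDominoTilings (sweepRegion n (c + 1) n (S \ {c}) (E \ {c})) := by
  have e : c - 1 + 1 = c := by ring
  rw [numDominoTilings_eq_add _ (c - 1) c, if_pos, if_neg, if_neg, if_neg, e,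
    add_zero, add_zero, add_zero]
  · congr 1
    ext ⟨x, y⟩
    simp only [Finset.mem_sdiff, Finset.mem_insert, Finset.mem_singleton, mem_sweepRegion hc,
      mem_sweepRegion (by omega : 0 ≤ c + 1), Prod.mk.injEq]
    unfold SweepCell
    simp only [Set.mem_sdiff, Set.mem_singleton_iff]
    grind (splits := 40)
  all_goals
    rw [mem_sweepRegion hc]
    unfold SweepCell
    grind (splits := 40)

theorem sweep_sink_of_succ_mem (hc : 0 ≤ c) (hcn : c < n) (hE : c ∈ E) (hS : c ∉ S)
    (hS' : c + 1 ∈ S) : numDominoTilings (sweepRegion n c 0 S E) =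
      numDominoTilings (sweepRegion n (c + 1) n (S \ {c + 1}) (E \ {c})) := by
  rw [numDominoTilings_eq_add _ c c, if_neg, if_neg, if_pos, if_neg,
    add_zero, add_zero, zero_add]
  · congr 1
    ext ⟨x, y⟩
    simp only [Finset.mem_sdiff, Finset.mem_insert, Finset.mem_singleton, mem_sweepRegion hc,
      mem_sweepRegion (by omega : 0 ≤ c + 1), Prod.mk.injEq]
    unfold SweepCell
    simp only [Set.mem_sdiff, Set.mem_singleton_iff]
    grind (splits := 40)
  all_goals
    rw [mem_sweepRegion hc]
    unfold SweepCell
    grind (splits := 40)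

theorem sweep_sink_eq_zero (hc : 0 ≤ c) (hcn : c < n) (hE : c ∈ E) (hS : c ∉ S)
    (hS' : c + 1 ∉ S) : numDominoTilings (sweepRegion n c 0 S E) = 0 := by
  rw [numDominoTilings_eq_add _ c c, if_neg, if_neg, if_neg, if_neg]
  all_goals
    rw [mem_sweepRegion hc]
    unfold SweepCell
    grind (splits := 40)

theorem sweep_dent_eq_zero (hc : 0 ≤ c) (hcn : c < n) (hE : c ∉ E) (hS : c ∈ S) :
    numDominoTilings (sweepRegion n c 0 S E) = 0 := by
  rw [numDominoTilings_eq_add _ (c - 1) c, if_neg, if_neg, if_neg, if_neg]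
  all_goals
    rw [mem_sweepRegion hc]
    unfold SweepCell
    grind (splits := 40)

theorem sweep_dent_of_notMem (hc : 0 ≤ c) (hE : c ∉ E) (hS : c ∉ S) :
    sweepRegion n c 0 S E = sweepRegion n (c + 1) n S E := by
  ext ⟨x, y⟩
  rw [mem_sweepRegion hc, mem_sweepRegion (by omega : 0 ≤ c + 1)]
  unfold SweepCell
  grind (splits := 40)

theorem sweepRegion_end : sweepRegion n n n ∅ E = ∅ := by
  ext ⟨x, y⟩
  rw [mem_sweepRegion (by omega)]
  unfold SweepCell
  simp only [Set.mem_empty_iff_false, Finset.notMem_empty]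
  grind (splits := 40)

end Steps

theorem aztecDiamond_eq_sweepRegion (n : ℕ) :
    aztecDiamond n = sweepRegion n 0 n (Set.Ico 0 n) (Set.Ico 0 n) := by
  ext ⟨x, y⟩
  rw [mem_sweepRegion le_rfl]
  simp only [aztecDiamond, Finset.mem_biUnion, Finset.mem_range, Finset.mem_image, Finset.mem_Ico,
    Prod.mk.injEq, SweepCell, Set.mem_Ico]
  constructor
  · rintro ⟨r, hr, x', hx', rfl, rfl⟩
    omega
  · intro h
    exact ⟨y.toNat, by omega, x, by omega, rfl, by omega⟩

theorem dentedAztecDiamond_eq_sweepRegion (n i j : ℕ) (hi : 1 ≤ i) (hj : 1 ≤ j) :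
    dentedAztecDiamond n i j =
      sweepRegion n 0 n (Set.Ico 0 n \ {(i : ℤ) - 1}) (Set.Ico 0 n \ {(j : ℤ) - 1}) := by
  ext ⟨x, y⟩
  rw [dentedAztecDiamond, aztecDiamond_eq_sweepRegion, mem_sweepRegion le_rfl, Finset.mem_sdiff,
    mem_sweepRegion le_rfl]
  simp only [Finset.mem_insert, Finset.mem_singleton, Prod.mk.injEq, SweepCell, Set.mem_Ico,
    Set.mem_sdiff, Set.mem_singleton_iff]
  grind (splits := 40)

/-! ### Multilinearity and the weights of path continuations. -/

/-- Adding multiples of one vector to the rows of a matrix. -/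
theorem Matrix.det_add_smul_rows {ι : Type*} [Fintype ι] [DecidableEq ι] {R : Type*} [CommRing R]
    (A : Matrix ι ι R) (c v : ι → R) :
    (Matrix.of fun a b => A a b + c a * v b).det = A.det + ∑ a, c a * (A.updateRow a v).det := by
  have key : ∀ t : Finset ι, (Matrix.of fun a b => A a b + (if a ∈ t then c a else 0) * v b).det =
      A.det + ∑ a ∈ t, c a * (A.updateRow a v).det := by
    intro t
    induction t using Finset.induction_on with
    | empty =>
      simp only [Finset.notMem_empty, if_false, zero_mul, add_zero, Finset.sum_empty]
      rfl
    | insert a t ha ih =>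
      rw [Finset.sum_insert ha, add_left_comm, ← ih]
      set B : Matrix ι ι R := Matrix.of fun a b => A a b + (if a ∈ t then c a else 0) * v b
        with hB
      have h1 : (Matrix.of fun x b => A x b + (if x ∈ insert a t then c x else 0) * v b) =
          B.updateRow a (B a + c a • v) := by
        ext x b
        by_cases hx : x = a
        · subst hx
          simp [hB, ha]
        · simp [hB, hx]
      -- Row `a` of both matrices is `v`, and the other rows differ by multiples of `v`.
      have h2 : (B.updateRow a v).det = (A.updateRow a v).det := by
        refine Matrix.det_eq_of_forall_row_eq_smul_add_const
          (fun x => if x ∈ t then c x else 0) a (if_neg ha) fun x b => ?_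
        by_cases hx : x = a
        · subst hx
          simp [ha]
        · simp [hB, hx]
      rw [h1, Matrix.det_updateRow_add, Matrix.updateRow_eq_self, Matrix.det_updateRow_smul, h2,
        add_comm]
  simpa using key Finset.univ

/-- The number of Delannoy paths from `(0, 0)` to `(l, d + 1)` whose last step, if there is one, is
`(0, 1)` or `(1, 1)`. -/
noncomputable def sinkDelannoy (l d : ℤ) : ℝ :=
  intDelannoy l d + intDelannoy (l - 1) d + if d = -1 ∧ l = 0 then 1 else 0

/-- The number of continuations of the lattice path whose end is the uncovered odd cell of row `y`
to the boundary cell `l` rows above row `c`, at the stage `(c, d)` of the sweep. -/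
noncomputable def sweepWeight (c d y l : ℤ) : ℝ :=
  if y < c + d then 2 * intDelannoy l (y - c)
  else if y = c + d then sinkDelannoy l (d - 1)
  else if y = c + d + 1 then sinkDelannoy l d
  else 2 * intDelannoy (l - 1) (y - c - 1)

theorem intDelannoy_rec_cast {x y : ℤ} (h : x ≠ 0 ∨ y ≠ 0) :
    (intDelannoy x y : ℝ) = intDelannoy (x - 1) y + intDelannoy x (y - 1)
      + intDelannoy (x - 1) (y - 1) := by
  rw [intDelannoy_rec h]
  push_cast
  ring

theorem sinkDelannoy_rec {l d : ℤ} (hd : 1 ≤ d) :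
    sinkDelannoy l d = 2 * intDelannoy (l - 1) d + sinkDelannoy l (d - 1) := by
  rw [sinkDelannoy, sinkDelannoy, if_neg (by omega), if_neg (by omega),
    intDelannoy_rec_cast (x := l) (y := d) (by omega)]
  ring

/-- One copy of `intDelannoy l d` is expanded by the recurrence. At the origin, where that fails,
the correction term of `sinkDelannoy` supplies the missing `1`. -/
theorem two_mul_intDelannoy {l d : ℤ} (hl : 0 ≤ l) (hd : 0 ≤ d) :
    2 * (intDelannoy l d : ℝ) = sinkDelannoy l (d - 1) + sinkDelannoy l d := by
  rw [sinkDelannoy, sinkDelannoy, if_neg (c := d = -1 ∧ l = 0) (by omega)]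
  by_cases h : l ≠ 0 ∨ d ≠ 0
  · rw [if_neg (by omega), intDelannoy_rec_cast h]
    ring
  · push Not at h
    obtain ⟨rfl, rfl⟩ := h
    rw [intDelannoy_zero_zero, intDelannoy_of_neg (by omega), intDelannoy_of_neg (by omega),
      intDelannoy_of_neg (by omega)]
    norm_num

/-- Mirrors a sweep step: a path end in a row adjacent to `c + d` may stay or move to row `c + d`.
On matrices of weights this is a rank-one update. -/
theorem sweepWeight_step {c d y l : ℤ} (hd : 1 ≤ d) (hl : 0 ≤ l) :
    sweepWeight c d y l = sweepWeight c (d - 1) y l +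
      (if y = c + d + 1 ∨ y = c + d - 1 then 1 else 0) * sweepWeight c (d - 1) (c + d) l := by
  have h0 : sweepWeight c (d - 1) (c + d) l = sinkDelannoy l (d - 1) := by
    rw [sweepWeight, if_neg (by omega), if_neg (by omega), if_pos (by omega)]
  rw [h0]
  rcases lt_trichotomy y (c + d) with h | h | h
  · by_cases h1 : y = c + d - 1
    · subst h1
      rw [sweepWeight, if_pos (by omega), sweepWeight, if_neg (by omega), if_pos (by omega),
        if_pos (by omega), one_mul, two_mul_intDelannoy hl (by omega)]
      congr 2 <;> ring
    · rw [sweepWeight, if_pos (by omega), sweepWeight, if_pos (by omega), if_neg (by omega),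
        zero_mul, add_zero]
  · subst h
    rw [sweepWeight, if_neg (by omega), if_pos rfl, h0, if_neg (by omega), zero_mul, add_zero]
  · by_cases h1 : y = c + d + 1
    · subst h1
      rw [sweepWeight, if_neg (by omega), if_neg (by omega), if_pos rfl, sweepWeight,
        if_neg (by omega), if_neg (by omega), if_neg (by omega), if_pos (by omega), one_mul,
        sinkDelannoy_rec hd]
      congr 4
      ring
    · rw [sweepWeight, if_neg (by omega), if_neg (by omega), if_neg (by omega), sweepWeight,
        if_neg (by omega), if_neg (by omega), if_neg (by omega), if_neg (by omega), zero_mul,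
        add_zero]

theorem sweepWeight_top {c d y l : ℤ} (hy : y < c + d) :
    sweepWeight c d y l = 2 * intDelannoy l (y - c) := if_pos hy

theorem sweepWeight_zero_self (c l : ℤ) : sweepWeight c 0 c l = if l = 0 then 1 else 0 := by
  rw [sweepWeight, if_neg (by omega), if_pos (by omega), sinkDelannoy,
    intDelannoy_of_neg (by omega), intDelannoy_of_neg (by omega)]
  simp

/-- The weights at the end of diagonal `c` are those at the start of diagonal `c + 1`. -/
theorem sweepWeight_zero_of_lt {c y l : ℤ} (hy : c < y) (hl : 1 ≤ l) :
    sweepWeight c 0 y l = 2 * intDelannoy (l - 1) (y - (c + 1)) := by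
  rw [sweepWeight, if_neg (by omega), if_neg (by omega)]
  split_ifs with h
  · subst h
    rw [sinkDelannoy, if_neg (by omega), intDelannoy_rec_cast (by omega),
      intDelannoy_of_neg (x := l) (by omega), intDelannoy_of_neg (x := l - 1) (y := 0 - 1)
        (by omega), show c + 0 + 1 - (c + 1) = 0 by ring]
    push_cast
    ring
  · congr 3
    ring

theorem sweepWeight_zero_zero {c y : ℤ} (hy : c < y) :
    sweepWeight c 0 y 0 = if y = c + 1 then 1 else 0 := by
  rw [sweepWeight, if_neg (by omega), if_neg (by omega), add_zero]
  split_ifs with h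
  · rw [sinkDelannoy, intDelannoy_zero_zero, intDelannoy_of_neg (by omega), if_neg (by omega)]
    norm_num
  · rw [intDelannoy_of_neg (by omega)]
    norm_num

/-! ### The sweep in terms of determinants. -/

theorem Function.range_update_of_injective {α β : Type*} [DecidableEq α] {f : α → β}
    (hf : f.Injective) (a : α) (b : β) :
    Set.range (Function.update f a b) = insert b (Set.range f \ {f a}) := by
  ext y
  simp only [Set.mem_range, Set.mem_insert_iff, Set.mem_sdiff, Set.mem_singleton_iff]
  constructor
  · rintro ⟨x, rfl⟩
    by_cases h : x = a
    · exact Or.inl (by rw [h, Function.update_self])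
    · rw [Function.update_of_ne h]
      exact Or.inr ⟨⟨x, rfl⟩, fun h' => h (hf h')⟩
  · rintro (rfl | ⟨⟨x, rfl⟩, h⟩)
    · exact ⟨a, Function.update_self ..⟩
    · exact ⟨x, Function.update_of_ne (fun h' => h (congrArg f h')) _ _⟩

/-- Path ends never overtake each other, which is why no signs appear in the determinant recursion.
-/
theorem StrictMono.update_of_adjacent {m : ℕ} {s : Fin m → ℤ} (hs : StrictMono s) {a : Fin m}
    {y : ℤ} (ha : s a = y + 1 ∨ s a = y - 1) (hy : y ∉ Set.range s) :
    StrictMono (Function.update s a y) := by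
  intro i j hij
  have hi : s i ≠ y := fun h => hy ⟨i, h⟩
  have hj : s j ≠ y := fun h => hy ⟨j, h⟩
  have := hs hij
  by_cases h1 : i = a
  · subst h1
    rw [Function.update_self, Function.update_of_ne hij.ne']
    omega
  · rw [Function.update_of_ne h1]
    by_cases h2 : j = a
    · subst h2
      rw [Function.update_self]
      omega
    · rwa [Function.update_of_ne h2]

theorem StrictMono.range_comp_succ {m : ℕ} {s : Fin (m + 1) → ℤ} (hs : StrictMono s) :
    Set.range (s ∘ Fin.succ) = Set.range s \ {s 0} := by
  ext y
  simp only [Set.mem_range, Function.comp, Set.mem_sdiff, Set.mem_singleton_iff]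
  constructor
  · rintro ⟨x, rfl⟩
    exact ⟨⟨_, rfl⟩, (hs (Fin.succ_pos x)).ne'⟩
  · rintro ⟨⟨x, rfl⟩, h⟩
    obtain ⟨z, rfl⟩ := Fin.exists_succ_eq.2 fun h' => h (congrArg s h')
    exact ⟨z, rfl⟩

theorem StrictMono.apply_zero_eq {m : ℕ} {s : Fin (m + 1) → ℤ} (hs : StrictMono s) {c : ℤ}
    (hc : c ∈ Set.range s) (hle : ∀ a, c ≤ s a) : s 0 = c := by
  obtain ⟨k, hk⟩ := hc
  exact le_antisymm (hk ▸ hs.monotone (Fin.zero_le k)) (hle 0)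

open Classical in
theorem sum_ite_apply_eq {m : ℕ} {s : Fin m → ℤ} (hs : StrictMono s) (y : ℤ) (x : Fin m → ℝ)
    (z : ℝ) (hx : ∀ a, s a = y → x a = z) :
    ∑ a, (if s a = y then x a else 0) = if y ∈ Set.range s then z else 0 := by
  split_ifs with h
  · obtain ⟨a, rfl⟩ := h
    rw [Finset.sum_eq_single a, if_pos rfl, hx a rfl]
    · intro b _ hb
      exact if_neg fun h => hb (hs.injective h)
    · simp
  · exact Finset.sum_eq_zero fun a _ => if_neg fun h' => h ⟨a, h'⟩

/-- One step of the sweep, in terms of determinants. -/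
theorem det_sweep_step {n : ℕ} {c d : ℤ} (hc : 0 ≤ c) (hcn : c < n) (hd : 1 ≤ d) (hdn : d ≤ n)
    (ih : ∀ (m : ℕ) (s e : Fin m → ℤ), StrictMono s →
      (∀ a, c ≤ s a ∧ (s a < c + n ∨ s a = c + n ∧ d - 1 < n)) → StrictMono e →
      (∀ b, c ≤ e b ∧ e b < n) →
      (numDominoTilings (sweepRegion n c (d - 1) (Set.range s) (Set.range e)) : ℝ) =
        (Matrix.of fun a b => sweepWeight c (d - 1) (s a) (e b - c)).det)
    (m : ℕ) (s e : Fin m → ℤ) (hs : StrictMono s)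
    (hsc : ∀ a, c ≤ s a ∧ (s a < c + n ∨ s a = c + n ∧ d < n)) (he : StrictMono e)
    (hec : ∀ b, c ≤ e b ∧ e b < n) :
    (numDominoTilings (sweepRegion n c d (Set.range s) (Set.range e)) : ℝ) =
      (Matrix.of fun a b => sweepWeight c d (s a) (e b - c)).det := by
  classical
  have hM : (Matrix.of fun a b => sweepWeight c d (s a) (e b - c)) =
      Matrix.of fun a b => (Matrix.of fun a b => sweepWeight c (d - 1) (s a) (e b - c)) a b +
        (if s a = c + d + 1 ∨ s a = c + d - 1 then 1 else 0) *
          sweepWeight c (d - 1) (c + d) (e b - c) := by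
    ext a b
    exact sweepWeight_step hd (by linarith [(hec b).1])
  by_cases hy : c + d ∈ Set.range s
  · have hdn' : d < n := by
      obtain ⟨k, hk⟩ := hy
      have := hsc k
      omega
    rw [sweep_step_of_mem hc hcn hd hdn' hy, ih m s e hs (fun a => ⟨(hsc a).1, by
      have := (hsc a).2; omega⟩) he hec, hM]
    obtain ⟨k, hk⟩ := hy
    -- The added vector is already row `k`, so the determinant does not change, in accordance with
    -- the forced domino.
    refine (Matrix.det_eq_of_forall_row_eq_smul_add_const
      (fun a => if s a = c + d + 1 ∨ s a = c + d - 1 then (1 : ℝ) else 0) k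
      (if_neg (by omega)) fun a b => ?_).symm
    simp only [Matrix.of_apply, hk]
  -- Each term of the rank-one expansion replaces one row by the weights of row `c + d`, that is,
  -- moves one path end there.
  · have hupd : ∀ a, (s a = c + d + 1 ∨ s a = c + d - 1) →
        ((Matrix.of fun a b => sweepWeight c (d - 1) (s a) (e b - c)).updateRow a
          fun b => sweepWeight c (d - 1) (c + d) (e b - c)).det =
        (numDominoTilings (sweepRegion n c (d - 1)
          (insert (c + d) (Set.range s \ {s a})) (Set.range e)) : ℝ) := by
      intro a ha
      rw [← Function.range_update_of_injective hs.injective, ih m _ e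
        (hs.update_of_adjacent ha hy) _ he hec]
      · congr 1
        ext x b
        by_cases hx : x = a
        · subst hx
          simp
        · simp [hx]
      · intro x
        by_cases hx : x = a
        · subst hx
          rw [Function.update_self]
          omega
        · rw [Function.update_of_ne hx]
          have := hsc x
          omega
    rw [sweep_step_of_notMem hc hcn hd hdn hy (by rintro _ ⟨a, rfl⟩; have := hsc a; omega), hM,
      Matrix.det_add_smul_rows]
    push_cast
    rw [ih m s e hs (fun a => ⟨(hsc a).1, by have := (hsc a).2; omega⟩) he hec, add_assoc]
    congr 1
    rw [← sum_ite_apply_eq hs (c + d + 1) (fun a => (numDominoTilings (sweepRegion n c (d - 1)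
          (insert (c + d) (Set.range s \ {s a})) (Set.range e)) : ℝ)) _ (fun a ha => by rw [ha]),
      ← sum_ite_apply_eq hs (c + d - 1) (fun a => (numDominoTilings (sweepRegion n c (d - 1)
          (insert (c + d) (Set.range s \ {s a})) (Set.range e)) : ℝ)) _ (fun a ha => by rw [ha]),
      ← Finset.sum_add_distrib]
    refine Finset.sum_congr rfl fun a _ => ?_
    by_cases h1 : s a = c + d + 1
    · rw [if_pos h1, if_neg (by omega), if_pos (Or.inl h1), hupd a (Or.inl h1)]
      ring
    · by_cases h2 : s a = c + d - 1
      · rw [if_neg h1, if_pos h2, if_pos (Or.inr h2), hupd a (Or.inr h2)]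
        ring
      · rw [if_neg h1, if_neg h2, if_neg (by tauto)]
        ring

/-- The last step in a column of the sweep, in terms of determinants. -/
theorem det_sweep_sink {n : ℕ} {c : ℤ} (hc : 0 ≤ c) (hcn : c < n)
    (ih : ∀ (m : ℕ) (s e : Fin m → ℤ), StrictMono s →
      (∀ a, c + 1 ≤ s a ∧ s a < c + 1 + n) → StrictMono e → (∀ b, c + 1 ≤ e b ∧ e b < n) →
      (numDominoTilings (sweepRegion n (c + 1) n (Set.range s) (Set.range e)) : ℝ) =
        (Matrix.of fun a b => 2 * (intDelannoy (e b - (c + 1)) (s a - (c + 1)) : ℝ)).det)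
    (m : ℕ) (s e : Fin m → ℤ) (hs : StrictMono s) (hsc : ∀ a, c ≤ s a ∧ s a ≤ c + n)
    (he : StrictMono e) (hec : ∀ b, c ≤ e b ∧ e b < n) :
    (numDominoTilings (sweepRegion n c 0 (Set.range s) (Set.range e)) : ℝ) =
      (Matrix.of fun a b => sweepWeight c 0 (s a) (e b - c)).det := by
  have hlt : ∀ y l : ℤ, c < y → c < l →
      sweepWeight c 0 y (l - c) = 2 * (intDelannoy (l - (c + 1)) (y - (c + 1)) : ℝ) := by
    intro y l hy hl
    rw [sweepWeight_zero_of_lt hy (by omega)]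
    congr 3
    ring
  by_cases hE : c ∈ Set.range e
  · obtain ⟨m, rfl⟩ : ∃ m', m = m' + 1 := by
      obtain ⟨k, -⟩ := hE
      exact ⟨m - 1, by have := k.2; omega⟩
    have he0 : e 0 = c := he.apply_zero_eq hE fun b => (hec b).1
    have he1 : ∀ b : Fin m, c < e b.succ := fun b => he0 ▸ he (Fin.succ_pos b)
    have hsub : ∀ s' : Fin m → ℤ, StrictMono s' → (∀ a, c < s' a ∧ s' a ≤ c + n) →
        (numDominoTilings (sweepRegion n (c + 1) n (Set.range s') (Set.range e \ {c})) : ℝ) =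
          (Matrix.of fun a b => sweepWeight c 0 (s' a) (e (Fin.succ b) - c)).det := by
      intro s' hs' hsc'
      rw [← he0, ← he.range_comp_succ, he0, ih m s' _ hs'
        (fun a => ⟨by have := hsc' a; omega, by have := hsc' a; omega⟩)
        (he.comp (Fin.strictMono_succ))
        (fun b => ⟨he1 b, (hec _).2⟩)]
      congr 1
      ext a b
      exact (hlt _ _ (hsc' a).1 (he1 b)).symm
    by_cases hS : c ∈ Set.range s
    · have hs0 : s 0 = c := hs.apply_zero_eq hS fun a => (hsc a).1
      -- The first row is `(1, 0, …, 0)`: the path in row `c` must end at once.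
      rw [sweep_sink_of_mem hc hcn hE hS, Matrix.det_succ_row_zero, Fin.sum_univ_succ,
        Finset.sum_eq_zero, add_zero]
      · simp only [Matrix.of_apply, hs0, he0, sub_self, sweepWeight_zero_self, if_true]
        have := hsub (s ∘ Fin.succ) (hs.comp (Fin.strictMono_succ)) fun a =>
          ⟨hs0 ▸ hs (Fin.succ_pos a), (hsc _).2⟩
        rw [hs.range_comp_succ, hs0] at this
        rw [this]
        simp only [Fin.val_zero, pow_zero, one_mul]
        rfl
      · intro b _
        simp only [Matrix.of_apply, hs0, sweepWeight_zero_self]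
        rw [if_neg (by have := he1 b; omega)]
        ring
    · have hlt' : ∀ a, c < s a := fun a => lt_of_le_of_ne (hsc a).1 fun h => hS ⟨a, h.symm⟩
      have hcol : ∀ a, sweepWeight c 0 (s a) (e 0 - c) = if s a = c + 1 then 1 else 0 := by
        intro a
        rw [he0, sub_self, sweepWeight_zero_zero (hlt' a)]
      by_cases hS' : c + 1 ∈ Set.range s
      · have hs0 : s 0 = c + 1 := hs.apply_zero_eq hS' fun a => hlt' a
        have hs1 : ∀ a : Fin m, c + 1 < s a.succ := fun a => hs0 ▸ hs (Fin.succ_pos a)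
        -- The first column is `(1, 0, …, 0)`: only a path ending in row `c + 1` reaches this sink.
        rw [sweep_sink_of_succ_mem hc hcn hE hS hS', Matrix.det_succ_column_zero,
          Fin.sum_univ_succ, Finset.sum_eq_zero, add_zero]
        · have := hsub (s ∘ Fin.succ) (hs.comp (Fin.strictMono_succ)) fun a =>
            ⟨hlt' _, (hsc _).2⟩
          rw [hs.range_comp_succ, hs0] at this
          rw [this, Matrix.of_apply, hcol, if_pos hs0]
          simp only [Fin.val_zero, pow_zero, one_mul]
          rfl
        · intro a _
          rw [Matrix.of_apply, hcol, if_neg (hs1 a).ne']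
          ring
      · rw [sweep_sink_eq_zero hc hcn hE hS hS', Nat.cast_zero,
          Matrix.det_eq_zero_of_column_eq_zero 0]
        intro a
        rw [Matrix.of_apply, hcol, if_neg fun h => hS' ⟨a, h⟩]
  · have hElt : ∀ b, c < e b := fun b => lt_of_le_of_ne (hec b).1 fun h => hE ⟨b, h.symm⟩
    by_cases hS : c ∈ Set.range s
    · rw [sweep_dent_eq_zero hc hcn hE hS, Nat.cast_zero]
      obtain ⟨k, hk⟩ := hS
      rw [Matrix.det_eq_zero_of_row_eq_zero k]
      intro b
      rw [Matrix.of_apply, hk, sweepWeight_zero_self, if_neg (by have := hElt b; omega)]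
    · have hlt' : ∀ a, c < s a := fun a => lt_of_le_of_ne (hsc a).1 fun h => hS ⟨a, h.symm⟩
      rw [sweep_dent_of_notMem hc hE hS, ih m s e hs
        (fun a => ⟨hlt' a, by have := hsc a; omega⟩) he fun b => ⟨hElt b, (hec b).2⟩]
      congr 1
      ext a b
      exact (hlt _ _ (hlt' a) (hElt b)).symm

/-- Outer induction on the number `k = n - c` of diagonals still to be swept, inner induction on `d`
along a diagonal. The sets of rows must be arbitrary, since the sweep changes them. -/
theorem numDominoTilings_sweepRegion_eq_det (n k : ℕ) (hk : k ≤ n) (m : ℕ) (s e : Fin m → ℤ)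
    (hs : StrictMono s) (hsc : ∀ a, (n - k : ℤ) ≤ s a ∧ s a < (n - k : ℤ) + n)
    (he : StrictMono e) (hec : ∀ b, (n - k : ℤ) ≤ e b ∧ e b < n) :
    (numDominoTilings (sweepRegion n (n - k) n (Set.range s) (Set.range e)) : ℝ) =
      (Matrix.of fun a b => 2 * (intDelannoy (e b - (n - k)) (s a - (n - k)) : ℝ)).det := by
  induction k generalizing m with
  | zero =>
    cases m with
    | zero =>
      simp [Set.range_eq_empty, sweepRegion_end, numDominoTilings_empty]
    | succ m =>
      have := hec 0
      push_cast at this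
      omega
  | succ k ih =>
    have hcol : ∀ d : ℕ, d ≤ n → ∀ (m : ℕ) (s e : Fin m → ℤ), StrictMono s →
        (∀ a, (n - (k + 1 : ℕ) : ℤ) ≤ s a ∧ (s a < (n - (k + 1 : ℕ) : ℤ) + n ∨
          s a = (n - (k + 1 : ℕ) : ℤ) + n ∧ (d : ℤ) < n)) → StrictMono e →
        (∀ b, (n - (k + 1 : ℕ) : ℤ) ≤ e b ∧ e b < n) →
        (numDominoTilings (sweepRegion n (n - (k + 1 : ℕ)) d (Set.range s) (Set.range e)) : ℝ) =
          (Matrix.of fun a b =>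
            sweepWeight (n - (k + 1 : ℕ)) d (s a) (e b - (n - (k + 1 : ℕ)))).det := by
      intro d
      induction d with
      | zero =>
        intro _ m s e hs hsc he hec
        refine det_sweep_sink (by omega) (by omega) ?_ m s e hs
          (fun a => ⟨(hsc a).1, by have := hsc a; omega⟩) he hec
        have hkk : ((n : ℤ) - (k + 1 : ℕ) + 1) = n - k := by push_cast; ring
        rw [hkk]
        exact fun m s e hs hsc he hec => ih (by omega) m s e hs hsc he hec
      | succ d ihd =>
        intro hd m s e hs hsc he hec
        refine det_sweep_step (by omega) (by omega) (by omega) (by omega) ?_ m s e hs hsc he hec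
        rw [show ((d + 1 : ℕ) : ℤ) - 1 = d by push_cast; ring]
        exact ihd (by omega)
    rw [hcol n le_rfl m s e hs (fun a => ⟨(hsc a).1, Or.inl (hsc a).2⟩) he hec]
    congr 1
    ext a b
    exact sweepWeight_top (hsc a).2

/-! ### Tiling counts of the plain and the dented diamond. -/

/-- Tilings of an Aztec diamond with prescribed cells on its two lower boundaries are counted by a
minor of twice the Delannoy matrix. -/
theorem numDominoTilings_sweepRegion_eq_det_submatrix (n m : ℕ) (s e : Fin m → Fin n)
    (hs : StrictMono s) (he : StrictMono e) :
    (numDominoTilings (sweepRegion n 0 n (Set.range fun a => ((s a : ℕ) : ℤ))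
      (Set.range fun b => ((e b : ℕ) : ℤ))) : ℝ) =
      (((2 : ℝ) • delannoyMatrix n).submatrix e s).det := by
  have h := numDominoTilings_sweepRegion_eq_det n n le_rfl m (fun a => ((s a : ℕ) : ℤ))
    (fun b => ((e b : ℕ) : ℤ)) (fun a b hab => Int.ofNat_lt.2 (hs hab))
    (fun a => ⟨by omega, by have := (s a).2; omega⟩) (fun a b hab => Int.ofNat_lt.2 (he hab))
    (fun b => ⟨by omega, by have := (e b).2; omega⟩)
  rw [sub_self] at h
  rw [h, ← Matrix.det_transpose]
  congr 1

theorem numDominoTilings_aztecDiamond_eq_det (n : ℕ) :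
    (numDominoTilings (aztecDiamond n) : ℝ) = ((2 : ℝ) • delannoyMatrix n).det := by
  have h := numDominoTilings_sweepRegion_eq_det_submatrix n n id id strictMono_id strictMono_id
  have hr : (Set.range fun a : Fin n => (((id a : Fin n) : ℕ) : ℤ)) = Set.Ico 0 (n : ℤ) := by
    ext y
    simp only [Set.mem_range, Set.mem_Ico, id]
    constructor
    · rintro ⟨a, rfl⟩
      have := a.2
      omega
    · rintro ⟨h0, h1⟩
      exact ⟨⟨y.toNat, by omega⟩, by simp [h0]⟩
  rw [hr, Matrix.submatrix_id_id] at h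
  rw [aztecDiamond_eq_sweepRegion, h]

theorem range_coe_succAbove (m : ℕ) (p : Fin (m + 1)) :
    (Set.range fun a : Fin m => ((p.succAbove a : ℕ) : ℤ)) =
      Set.Ico 0 ((m + 1 : ℕ) : ℤ) \ {((p : ℕ) : ℤ)} := by
  ext y
  simp only [Set.mem_range, Set.mem_Ico, Set.mem_sdiff, Set.mem_singleton_iff]
  constructor
  · rintro ⟨a, rfl⟩
    have h1 := (p.succAbove a).2
    have h2 := Fin.val_ne_of_ne (Fin.succAbove_ne p a)
    omega
  · rintro ⟨⟨h0, h1⟩, h2⟩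
    obtain ⟨a, ha⟩ := Fin.exists_succAbove_eq (x := ⟨y.toNat, by omega⟩) (y := p)
      (by rw [ne_eq, Fin.ext_iff]; simp only; omega)
    exact ⟨a, by rw [ha]; simp [h0]⟩

theorem numDominoTilings_dentedAztecDiamond_eq_det (m : ℕ) (p q : Fin (m + 1)) :
    (numDominoTilings (dentedAztecDiamond (m + 1) (p + 1) (q + 1)) : ℝ) =
      (((2 : ℝ) • delannoyMatrix (m + 1)).submatrix q.succAbove p.succAbove).det := by
  rw [← numDominoTilings_sweepRegion_eq_det_submatrix (m + 1) m p.succAbove q.succAbove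
    (Fin.strictMono_succAbove p) (Fin.strictMono_succAbove q), range_coe_succAbove,
    range_coe_succAbove, dentedAztecDiamond_eq_sweepRegion _ _ _ (by omega) (by omega)]
  push_cast
  simp only [add_sub_cancel_right]

theorem numDominoTilings_aztecDiamond_pos (n : ℕ) : 0 < numDominoTilings (aztecDiamond n) := by
  rw [Nat.pos_iff_ne_zero]
  intro h0
  have h1 := numDominoTilings_aztecDiamond_eq_det n
  have h2 := congrArg Matrix.det (delannoyMatrix_mul_delannoyInverse n)
  rw [Matrix.det_mul, Matrix.det_one] at h2
  rw [h0, Nat.cast_zero, Matrix.det_smul] at h1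
  rcases mul_eq_zero.1 h1.symm with h | h
  · exact absurd h (by positivity)
  · rw [h, zero_mul] at h2
    exact zero_ne_one h2

theorem numDominoTilings_dentedAztecDiamond (n i j : ℕ) (hi : 1 ≤ i) (hin : i ≤ n) (hj : 1 ≤ j)
    (hjn : j ≤ n) : (numDominoTilings (dentedAztecDiamond n i j) : ℝ) =
      numDominoTilings (aztecDiamond n) *
        ∑ k ∈ Finset.range n, (k.choose (i - 1) : ℝ) * k.choose (j - 1) / 2 ^ (k + 1) := by
  obtain ⟨m, rfl⟩ : ∃ m, n = m + 1 := ⟨n - 1, by omega⟩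
  have h := abs_det_minor_two_smul_delannoyMatrix m ⟨j - 1, by omega⟩ ⟨i - 1, by omega⟩
  -- Both determinants count tilings, so the absolute values can be dropped.
  rw [← numDominoTilings_dentedAztecDiamond_eq_det, ← numDominoTilings_aztecDiamond_eq_det,
    Nat.abs_cast, Nat.abs_cast] at h
  simp only [Nat.sub_add_cancel hi, Nat.sub_add_cancel hj] at h
  rw [h]
  congr 1
  exact Finset.sum_congr rfl fun k _ => by ring

/-! ### The series for the Delannoy numbers. -/

theorem summable_choose_mul_choose_div (p q : ℕ) :
    Summable fun k : ℕ => (k.choose p : ℝ) * k.choose q / 2 ^ (k + 1) := by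
  have h : Summable fun k : ℕ => ((k : ℝ) ^ (p + q)) * (1 / 2 : ℝ) ^ k :=
    summable_pow_mul_geometric_of_norm_lt_one (p + q) (by norm_num)
  refine Summable.of_nonneg_of_le (fun k => by positivity) (fun k => ?_) h
  have h1 : (k.choose p : ℝ) ≤ (k : ℝ) ^ p := by exact_mod_cast Nat.choose_le_pow k p
  have h2 : (k.choose q : ℝ) ≤ (k : ℝ) ^ q := by exact_mod_cast Nat.choose_le_pow k q
  calc (k.choose p : ℝ) * k.choose q / 2 ^ (k + 1) ≤ (k : ℝ) ^ p * (k : ℝ) ^ q / 2 ^ k := by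
        gcongr
        · norm_num
        · omega
    _ = _ := by rw [pow_add, one_div, inv_pow, div_eq_mul_inv]

/-- Splitting off `k = 0` and applying Pascal's rule to the rest expresses the sum at `(p + 1, q +
1)` as half of itself plus half of its three predecessors: the Delannoy recurrence. -/
theorem tsum_choose_mul_choose_div (p q : ℕ) :
    ∑' k : ℕ, (k.choose p : ℝ) * k.choose q / 2 ^ (k + 1) = delannoy p q := by
  have e : ∀ p q : ℕ, ∑' k : ℕ, (k.choose p : ℝ) * k.choose q / 2 ^ (k + 1) =
      (Nat.choose 0 p : ℝ) * Nat.choose 0 q / 2 ^ (0 + 1) +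
        ∑' k : ℕ, ((k + 1).choose p : ℝ) * (k + 1).choose q / 2 ^ (k + 1 + 1) := fun p q =>
    (summable_choose_mul_choose_div p q).tsum_eq_zero_add
  have hs := summable_choose_mul_choose_div
  induction p generalizing q with
  | zero =>
    induction q with
    | zero =>
      have h := e 0 0
      have h2 : ∀ k : ℕ, ((k + 1).choose 0 : ℝ) * (k + 1).choose 0 / 2 ^ (k + 1 + 1) =
          1 / 2 * ((k.choose 0 : ℝ) * k.choose 0 / 2 ^ (k + 1)) := fun k => by
        simp only [Nat.choose_zero_right, pow_succ]
        ring
      simp only [h2, tsum_mul_left] at h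
      rw [delannoy_zero_left]
      norm_num at h ⊢
      linarith
    | succ q ih =>
      have h := e 0 (q + 1)
      have h2 : ∀ k : ℕ, ((k + 1).choose 0 : ℝ) * (k + 1).choose (q + 1) / 2 ^ (k + 1 + 1) =
          1 / 2 * ((k.choose 0 : ℝ) * k.choose q / 2 ^ (k + 1) +
            (k.choose 0 : ℝ) * k.choose (q + 1) / 2 ^ (k + 1)) := fun k => by
        simp only [Nat.choose_zero_right, pow_succ, Nat.choose_succ_succ']
        push_cast
        ring
      simp only [h2, tsum_mul_left] at h
      rw [(hs 0 q).tsum_add (hs 0 (q + 1)), ih, Nat.choose_zero_succ, Nat.cast_zero, mul_zero,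
        zero_div, zero_add] at h
      rw [delannoy_zero_left] at h ⊢
      linarith
  | succ p ihp =>
    induction q with
    | zero =>
      have h := e (p + 1) 0
      have h2 : ∀ k : ℕ, ((k + 1).choose (p + 1) : ℝ) * (k + 1).choose 0 / 2 ^ (k + 1 + 1) =
          1 / 2 * ((k.choose p : ℝ) * k.choose 0 / 2 ^ (k + 1) +
            (k.choose (p + 1) : ℝ) * k.choose 0 / 2 ^ (k + 1)) := fun k => by
        simp only [Nat.choose_zero_right, pow_succ, Nat.choose_succ_succ']
        push_cast
        ring
      simp only [h2, tsum_mul_left] at h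
      rw [(hs p 0).tsum_add (hs (p + 1) 0), ihp, Nat.choose_zero_succ, Nat.cast_zero, zero_mul,
        zero_div, zero_add] at h
      rw [delannoy_zero_right] at h ⊢
      linarith
    | succ q ihq =>
      have h := e (p + 1) (q + 1)
      have h2 : ∀ k : ℕ, ((k + 1).choose (p + 1) : ℝ) * (k + 1).choose (q + 1) / 2 ^ (k + 1 + 1) =
          1 / 2 * (((k.choose p : ℝ) * k.choose q / 2 ^ (k + 1) +
            (k.choose p : ℝ) * k.choose (q + 1) / 2 ^ (k + 1)) +
            ((k.choose (p + 1) : ℝ) * k.choose q / 2 ^ (k + 1) +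
            (k.choose (p + 1) : ℝ) * k.choose (q + 1) / 2 ^ (k + 1))) := fun k => by
        simp only [pow_succ, Nat.choose_succ_succ']
        push_cast
        ring
      simp only [h2, tsum_mul_left] at h
      rw [((hs p q).add (hs p (q + 1))).tsum_add ((hs (p + 1) q).add (hs (p + 1) (q + 1))),
        (hs p q).tsum_add (hs p (q + 1)), (hs (p + 1) q).tsum_add (hs (p + 1) (q + 1)),
        ihp, ihp, ihq, Nat.choose_zero_succ, Nat.cast_zero, zero_mul,
        zero_div, zero_add] at h
      rw [delannoy_succ_succ]
      push_cast
      linarith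

/-! ### Concentration of the series away from `k = n`. -/

/-- Geometric decay bounds the tail by `t n / (1 - r)`, while the `n - N` terms before `t n` are all
at least `t n`. So the tail is a fraction `O(1 / (n - N))` of the total, and no asymptotics of the
terms are needed. -/
theorem tail_le_of_ratio_le {t : ℕ → ℝ} (ht : ∀ k, 0 ≤ t k) (hs : Summable t) {r : ℝ}
    (hr1 : r < 1) {N n : ℕ} (hN : N ≤ n) (h : ∀ k, N ≤ k → t (k + 1) ≤ r * t k) :
    ((n : ℝ) - N) * (1 - r) * (∑' k, t k - ∑ k ∈ Finset.range n, t k) ≤ ∑' k, t k := by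
  have hanti : ∀ k l, N ≤ k → k ≤ l → t l ≤ t k := by
    intro k l hk hkl
    induction l, hkl using Nat.le_induction with
    | base => exact le_rfl
    | succ l hl ih =>
      have h1 := h l (by omega)
      nlinarith [ht l]
  have hT : ∑' k, t k - ∑ k ∈ Finset.range n, t k = ∑' k, t (k + n) := by
    rw [← hs.sum_add_tsum_nat_add n]
    ring
  have hsn : Summable fun k => t (k + n) := (summable_nat_add_iff n).2 hs
  have h1 : (1 - r) * ∑' k, t (k + n) ≤ t n := by
    have h2 := hsn.tsum_eq_zero_add
    have h3 : ∑' k, t (k + 1 + n) ≤ ∑' k, r * t (k + n) := by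
      refine Summable.tsum_le_tsum (fun k => ?_) ((summable_nat_add_iff 1).2 hsn)
        (hsn.mul_left r)
      rw [show k + 1 + n = k + n + 1 by ring]
      exact h _ (by omega)
    rw [tsum_mul_left] at h3
    rw [zero_add] at h2
    linarith
  have h4 : ((n : ℝ) - N) * t n ≤ ∑ k ∈ Finset.Ico N n, t k := by
    have := Finset.card_nsmul_le_sum (Finset.Ico N n) t (t n) fun k hk =>
      hanti k n (Finset.mem_Ico.1 hk).1 (Finset.mem_Ico.1 hk).2.le
    rwa [Nat.card_Ico, nsmul_eq_mul, Nat.cast_sub hN] at this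
  have h5 : ∑ k ∈ Finset.Ico N n, t k ≤ ∑' k, t k := hs.sum_le_tsum _ fun k _ => ht k
  have h6 : (0 : ℝ) ≤ (n : ℝ) - N := sub_nonneg.2 (by exact_mod_cast hN)
  rw [hT, mul_assoc]
  exact ((mul_le_mul_of_nonneg_left h1 h6).trans h4).trans h5

/-- The mirror image: the head is at most `t n / (1 - r)`, and the `N - n` terms from `t n` on are
at least `t n`. -/
theorem head_le_of_ratio_ge {t : ℕ → ℝ} (ht : ∀ k, 0 ≤ t k) (hs : Summable t) {r : ℝ}
    (hr0 : 0 ≤ r) (hr1 : r < 1) {N n : ℕ} (hN : n ≤ N) (h : ∀ k, k < N → t k ≤ r * t (k + 1)) :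
    ((N : ℝ) - n) * (1 - r) * ∑ k ∈ Finset.range n, t k ≤ ∑' k, t k := by
  have hmono : ∀ l, n ≤ l → l ≤ N → t n ≤ t l := by
    intro l hl
    induction l, hl using Nat.le_induction with
    | base => exact fun _ => le_rfl
    | succ l hl ih =>
      intro hlN
      have h1 := h l (by omega)
      have h2 := ih (by omega)
      nlinarith [ht (l + 1)]
  have h1 : (1 - r) * ∑ k ∈ Finset.range n, t k ≤ t n := by
    have h2 : ∑ k ∈ Finset.range n, t k ≤ ∑ k ∈ Finset.range n, r * t (k + 1) :=
      Finset.sum_le_sum fun k hk => h k (by have := Finset.mem_range.1 hk; omega)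
    have h3 := Finset.sum_range_succ' t n
    rw [Finset.sum_range_succ] at h3
    rw [← Finset.mul_sum] at h2
    nlinarith [ht n, ht 0, mul_nonneg hr0 (ht 0)]
  have h4 : ((N : ℝ) - n) * t n ≤ ∑ k ∈ Finset.Ico n N, t k := by
    have := Finset.card_nsmul_le_sum (Finset.Ico n N) t (t n) fun k hk =>
      hmono k (Finset.mem_Ico.1 hk).1 (Finset.mem_Ico.1 hk).2.le
    rwa [Nat.card_Ico, nsmul_eq_mul, Nat.cast_sub hN] at this
  have h5 : ∑ k ∈ Finset.Ico n N, t k ≤ ∑' k, t k := hs.sum_le_tsum _ fun k _ => ht k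
  have h6 : (0 : ℝ) ≤ (N : ℝ) - n := sub_nonneg.2 (by exact_mod_cast hN)
  rw [mul_assoc]
  exact ((mul_le_mul_of_nonneg_left h1 h6).trans h4).trans h5

/-- The `- 1` pays for rounding `(1 ± δ) n` to an integer. -/
theorem tendsto_zero_of_mul_le {n : ℕ → ℕ} (hn : Tendsto n atTop atTop) {f : ℕ → ℝ} {δ c : ℝ}
    (hδ : 0 < δ) (hc : 0 < c) (hf : ∀ᶠ k in atTop, 0 ≤ f k)
    (h : ∀ᶠ k in atTop, (δ * n k - 1) * c * f k ≤ 1) : Tendsto f atTop (𝓝 0) := by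
  have h1 : Tendsto (fun k => (δ * n k - 1) * c) atTop atTop :=
    ((tendsto_atTop_add_const_right _ (-1)
      ((tendsto_natCast_atTop_atTop.comp hn).const_mul_atTop hδ)).atTop_mul_const hc)
  refine squeeze_zero' hf ?_ h1.inv_tendsto_atTop
  filter_upwards [h, h1.eventually_gt_atTop 0] with k hk hpos
  rw [Pi.inv_apply, ← one_div, le_div_iff₀ hpos]
  linarith

theorem choose_mul_choose_ratio (p q k : ℕ) (hp : p ≤ k + 1) (hq : q ≤ k + 1) :
    ((k + 1).choose p : ℝ) * (k + 1).choose q / 2 ^ (k + 1 + 1) *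
      (2 * (((k + 1 : ℕ) : ℝ) - p) * (((k + 1 : ℕ) : ℝ) - q)) =
    (k.choose p : ℝ) * k.choose q / 2 ^ (k + 1) * ((k + 1 : ℕ) : ℝ) ^ 2 := by
  have h : ∀ p : ℕ, p ≤ k + 1 →
      ((k + 1).choose p : ℝ) * (((k + 1 : ℕ) : ℝ) - p) = k.choose p * ((k + 1 : ℕ) : ℝ) := by
    intro p hp
    rw [← Nat.cast_sub hp]
    exact_mod_cast (Nat.choose_mul_succ_eq k p).symm
  have h1 := h p hp
  have h2 := h q hq
  calc _ = (((k + 1).choose p : ℝ) * (((k + 1 : ℕ) : ℝ) - p)) *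
        (((k + 1).choose q : ℝ) * (((k + 1 : ℕ) : ℝ) - q)) / 2 ^ (k + 1) := by
        rw [pow_succ _ (k + 1)]
        field_simp
    _ = _ := by
        rw [h1, h2]
        ring

theorem choose_ratio_le {p q k n : ℕ} {α β x δ : ℝ} (hδ : δ < 1)
    (hα : (α + δ) / (1 - δ) < 1) (hβ : (β + δ) / (1 - δ) < 1)
    (hp : (p : ℝ) ≤ (α + δ) * n) (hq : (q : ℝ) ≤ (β + δ) * n)
    (hα0 : 0 ≤ α + δ) (hβ0 : 0 ≤ β + δ)
    (hx : x = (1 - (α + δ) / (1 - δ)) * (1 - (β + δ) / (1 - δ)))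
    (hk : (1 - δ) * n ≤ k) :
    ((k + 1).choose p : ℝ) * (k + 1).choose q / 2 ^ (k + 1 + 1) ≤
      1 / (2 * x) * ((k.choose p : ℝ) * k.choose q / 2 ^ (k + 1)) := by
  set X : ℝ := ((k + 1 : ℕ) : ℝ) with hX
  have hXpos : 0 < X := by positivity
  have h1δ : 0 < 1 - δ := by linarith
  have hkX : (1 - δ) * n ≤ X := by rw [hX]; push_cast; linarith
  have hnX : (n : ℝ) ≤ X / (1 - δ) := by rw [le_div_iff₀ h1δ]; linarith
  have key : ∀ (γ : ℝ) (s : ℕ), 0 ≤ γ + δ → (s : ℝ) ≤ (γ + δ) * n →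
      (1 - (γ + δ) / (1 - δ)) * X ≤ X - s := by
    intro γ s hγ hs
    have : (s : ℝ) ≤ (γ + δ) / (1 - δ) * X := by
      calc (s : ℝ) ≤ (γ + δ) * n := hs
        _ ≤ (γ + δ) * (X / (1 - δ)) := mul_le_mul_of_nonneg_left hnX hγ
        _ = _ := by ring
    linarith
  have k1 := key α p hα0 hp
  have k2 := key β q hβ0 hq
  have a1 := mul_pos (sub_pos.2 hα) hXpos
  have a2 := mul_pos (sub_pos.2 hβ) hXpos
  have hx0 : 0 < x := hx ▸ mul_pos (sub_pos.2 hα) (sub_pos.2 hβ)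
  have hpk : p ≤ k + 1 := by
    have : (p : ℝ) ≤ X := by linarith
    rw [hX] at this
    exact_mod_cast this
  have hqk : q ≤ k + 1 := by
    have : (q : ℝ) ≤ X := by linarith
    rw [hX] at this
    exact_mod_cast this
  have e := choose_mul_choose_ratio p q k hpk hqk
  rw [← hX] at e
  set T : ℝ := ((k + 1).choose p : ℝ) * (k + 1).choose q / 2 ^ (k + 1 + 1) with hT
  have hT0 : 0 ≤ T := by positivity
  have hprod : x * X ^ 2 ≤ (X - p) * (X - q) := by
    calc x * X ^ 2 = ((1 - (α + δ) / (1 - δ)) * X) * ((1 - (β + δ) / (1 - δ)) * X) := by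
          rw [hx]; ring
      _ ≤ _ := mul_le_mul k1 k2 a2.le (a1.le.trans k1)
  have h2 : T * (2 * x) * X ^ 2 ≤
      ((k.choose p : ℝ) * k.choose q / 2 ^ (k + 1)) * X ^ 2 := by
    rw [← e]
    nlinarith [mul_le_mul_of_nonneg_left hprod hT0]
  have h3 := le_of_mul_le_mul_right h2 (by positivity)
  rw [one_div, inv_mul_eq_div, le_div_iff₀ (by positivity)]
  exact h3

theorem choose_ratio_ge {p q k n : ℕ} {α β x δ : ℝ} (hδ : 0 < δ)
    (hα : (α - δ) / (1 + δ) < 1) (hβ : (β - δ) / (1 + δ) < 1)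
    (hp : (α - δ) * n ≤ p) (hq : (β - δ) * n ≤ q)
    (hα0 : 0 ≤ α - δ) (hβ0 : 0 ≤ β - δ)
    (hx : x = (1 - (α - δ) / (1 + δ)) * (1 - (β - δ) / (1 + δ)))
    (hk : ((k + 1 : ℕ) : ℝ) ≤ (1 + δ) * n) :
    (k.choose p : ℝ) * k.choose q / 2 ^ (k + 1) ≤
      2 * x * (((k + 1).choose p : ℝ) * (k + 1).choose q / 2 ^ (k + 1 + 1)) := by
  have hx0 : 0 < x := hx ▸ mul_pos (sub_pos.2 hα) (sub_pos.2 hβ)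
  by_cases hpq : p ≤ k + 1 ∧ q ≤ k + 1
  · obtain ⟨hpk, hqk⟩ := hpq
    have e := choose_mul_choose_ratio p q k hpk hqk
    have hpX : (p : ℝ) ≤ ((k + 1 : ℕ) : ℝ) := by exact_mod_cast hpk
    have hqX : (q : ℝ) ≤ ((k + 1 : ℕ) : ℝ) := by exact_mod_cast hqk
    have hXpos : (0 : ℝ) < ((k + 1 : ℕ) : ℝ) := by positivity
    set X : ℝ := ((k + 1 : ℕ) : ℝ) with hX
    have h1δ : 0 < 1 + δ := by linarith
    have hnX : X / (1 + δ) ≤ n := by rw [div_le_iff₀ h1δ]; linarith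
    have key : ∀ (γ : ℝ) (s : ℕ), 0 ≤ γ - δ → (γ - δ) * n ≤ s →
        X - s ≤ (1 - (γ - δ) / (1 + δ)) * X := by
      intro γ s hγ hs
      have : (γ - δ) / (1 + δ) * X ≤ s := by
        calc (γ - δ) / (1 + δ) * X = (γ - δ) * (X / (1 + δ)) := by ring
          _ ≤ (γ - δ) * n := mul_le_mul_of_nonneg_left hnX hγ
          _ ≤ s := hs
      linarith
    have k1 := key α p hα0 hp
    have k2 := key β q hβ0 hq
    set T : ℝ := ((k + 1).choose p : ℝ) * (k + 1).choose q / 2 ^ (k + 1 + 1) with hT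
    have hT0 : 0 ≤ T := by positivity
    have hprod : (X - p) * (X - q) ≤ x * X ^ 2 := by
      calc (X - p) * (X - q) ≤
          ((1 - (α - δ) / (1 + δ)) * X) * ((1 - (β - δ) / (1 + δ)) * X) :=
            mul_le_mul k1 k2 (by linarith) (by linarith [mul_pos (sub_pos.2 hα) hXpos])
        _ = x * X ^ 2 := by rw [hx]; ring
    have h2 : ((k.choose p : ℝ) * k.choose q / 2 ^ (k + 1)) * X ^ 2 ≤ 2 * x * T * X ^ 2 := by
      rw [← e]
      nlinarith [mul_le_mul_of_nonneg_left hprod hT0]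
    exact le_of_mul_le_mul_right h2 (by positivity)
  -- A factor `k + 1 - p` or `k + 1 - q` is now negative and the product estimate is unavailable,
  -- but the left side vanishes.
  · have h0 : (k.choose p : ℝ) * k.choose q = 0 := by
      rw [not_and_or] at hpq
      rcases hpq with h | h
      · rw [Nat.choose_eq_zero_of_lt (by omega : k < p)]
        simp
      · rw [Nat.choose_eq_zero_of_lt (by omega : k < q)]
        simp
    rw [h0, zero_div]
    positivity

section Limits

variable {a b : ℝ} {n p q : ℕ → ℕ}

theorem eventually_le_mul_of_tendsto_div (hn : Tendsto n atTop atTop)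
    (hp : Tendsto (fun k => (p k : ℝ) / (n k : ℝ)) atTop (𝓝 a)) {c : ℝ} (hc : a < c) :
    ∀ᶠ k in atTop, (p k : ℝ) ≤ c * n k := by
  filter_upwards [hp.eventually_lt_const hc, hn.eventually_gt_atTop 0] with k h1 h2
  have : (0 : ℝ) < n k := by exact_mod_cast h2
  exact ((div_lt_iff₀ this).1 h1).le

theorem eventually_mul_le_of_tendsto_div (hn : Tendsto n atTop atTop)
    (hp : Tendsto (fun k => (p k : ℝ) / (n k : ℝ)) atTop (𝓝 a)) {c : ℝ} (hc : c < a) :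
    ∀ᶠ k in atTop, c * n k ≤ (p k : ℝ) := by
  filter_upwards [hp.eventually_const_lt hc, hn.eventually_gt_atTop 0] with k h1 h2
  have : (0 : ℝ) < n k := by exact_mod_cast h2
  exact ((lt_div_iff₀ this).1 h1).le

theorem tsum_choose_mul_choose_div_pos (p q : ℕ) :
    0 < ∑' k : ℕ, (k.choose p : ℝ) * k.choose q / 2 ^ (k + 1) := by
  refine (summable_choose_mul_choose_div p q).tsum_pos (fun k => by positivity) (max p q) ?_
  have h1 := Nat.choose_pos (le_max_left p q)
  have h2 := Nat.choose_pos (le_max_right p q)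
  positivity

theorem tendsto_partial_sum_div_tsum_one (ha0 : 0 < a) (ha1 : a < 1) (hb0 : 0 < b) (hb1 : b < 1)
    (hab : 1 / 2 < (1 - a) * (1 - b)) (hn : Tendsto n atTop atTop)
    (hp : Tendsto (fun k => (p k : ℝ) / (n k : ℝ)) atTop (𝓝 a))
    (hq : Tendsto (fun k => (q k : ℝ) / (n k : ℝ)) atTop (𝓝 b)) :
    Tendsto (fun k => (∑ l ∈ Finset.range (n k),
      (l.choose (p k) : ℝ) * l.choose (q k) / 2 ^ (l + 1)) /
      ∑' l : ℕ, (l.choose (p k) : ℝ) * l.choose (q k) / 2 ^ (l + 1)) atTop (𝓝 1) := by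
  have hcont : ∀ c : ℝ, ContinuousAt (fun δ : ℝ => (c + δ) / (1 - δ)) 0 := fun c => by
    refine ContinuousAt.div (by fun_prop) (by fun_prop) (by norm_num)
  -- The strict inequality at `k = n` leaves room for an error `δ` in `p / n`, in `q / n` and in the
  -- starting index `(1 - δ) n`.
  have hex : ∀ᶠ δ in 𝓝[>] (0 : ℝ), 0 < δ ∧ δ < 1 ∧ (a + δ) / (1 - δ) < 1 ∧
      (b + δ) / (1 - δ) < 1 ∧
      1 / 2 < (1 - (a + δ) / (1 - δ)) * (1 - (b + δ) / (1 - δ)) := by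
    refine eventually_mem_nhdsWithin.and (Eventually.and ?_ (Eventually.and ?_
      (Eventually.and ?_ ?_)))
    · exact nhdsWithin_le_nhds (eventually_lt_nhds one_pos)
    · exact nhdsWithin_le_nhds ((hcont a).eventually_lt_const (by simpa using ha1))
    · exact nhdsWithin_le_nhds ((hcont b).eventually_lt_const (by simpa using hb1))
    · exact nhdsWithin_le_nhds
        ((((continuousAt_const).sub (hcont a)).mul
          ((continuousAt_const).sub (hcont b))).eventually_const_lt (by simpa using hab))
  obtain ⟨δ, hδ0, hδ1, hα, hβ, hx⟩ := hex.exists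
  set x := (1 - (a + δ) / (1 - δ)) * (1 - (b + δ) / (1 - δ)) with hxdef
  have hr : 1 / (2 * x) < 1 := by
    rw [div_lt_one (by linarith)]
    linarith
  set t : ℕ → ℕ → ℝ := fun k l => (l.choose (p k) : ℝ) * l.choose (q k) / 2 ^ (l + 1) with ht
  have ht0 : ∀ k l, 0 ≤ t k l := fun k l => by positivity
  have hts : ∀ k, Summable (t k) := fun k => summable_choose_mul_choose_div _ _
  have htp : ∀ k, 0 < ∑' l, t k l := fun k => tsum_choose_mul_choose_div_pos _ _
  have hle : ∀ k, ∑ l ∈ Finset.range (n k), t k l ≤ ∑' l, t k l := fun k =>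
    (hts k).sum_le_tsum _ fun l _ => ht0 k l
  have hzero : Tendsto (fun k => 1 - (∑ l ∈ Finset.range (n k), t k l) / ∑' l, t k l) atTop
      (𝓝 0) := by
    refine tendsto_zero_of_mul_le hn hδ0 (sub_pos.2 hr)
      (Eventually.of_forall fun k => sub_nonneg.2 ((div_le_one (htp k)).2 (hle k))) ?_
    filter_upwards [eventually_le_mul_of_tendsto_div hn hp (lt_add_of_pos_right a hδ0),
      eventually_le_mul_of_tendsto_div hn hq (lt_add_of_pos_right b hδ0)] with k hpk hqk
    have hnk : (0 : ℝ) ≤ n k := Nat.cast_nonneg _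
    have hceil : ⌈(1 - δ) * n k⌉₊ ≤ n k := by
      rw [Nat.ceil_le]
      nlinarith
    have htail := tail_le_of_ratio_le (ht0 k) (hts k) hr hceil fun l hl =>
      choose_ratio_le hδ1 hα hβ hpk hqk (by linarith) (by linarith) hxdef (Nat.ceil_le.1 hl)
    have hN : δ * n k - 1 ≤ (n k : ℝ) - ⌈(1 - δ) * n k⌉₊ := by
      have := Nat.ceil_lt_add_one (mul_nonneg (sub_nonneg.2 hδ1.le) hnk)
      linarith
    rw [one_sub_div (htp k).ne', mul_div_assoc', div_le_one (htp k)]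
    refine le_trans ?_ htail
    gcongr
    exact sub_nonneg.2 (hle k)
  simpa using hzero.const_sub 1

theorem tendsto_partial_sum_div_tsum_zero (ha0 : 0 < a) (ha1 : a < 1) (hb0 : 0 < b) (hb1 : b < 1)
    (hab : (1 - a) * (1 - b) < 1 / 2) (hn : Tendsto n atTop atTop)
    (hp : Tendsto (fun k => (p k : ℝ) / (n k : ℝ)) atTop (𝓝 a))
    (hq : Tendsto (fun k => (q k : ℝ) / (n k : ℝ)) atTop (𝓝 b)) :
    Tendsto (fun k => (∑ l ∈ Finset.range (n k),
      (l.choose (p k) : ℝ) * l.choose (q k) / 2 ^ (l + 1)) /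
      ∑' l : ℕ, (l.choose (p k) : ℝ) * l.choose (q k) / 2 ^ (l + 1)) atTop (𝓝 0) := by
  have hcont : ∀ c : ℝ, ContinuousAt (fun δ : ℝ => (c - δ) / (1 + δ)) 0 := fun c => by
    refine ContinuousAt.div (by fun_prop) (by fun_prop) (by norm_num)
  have hex : ∀ᶠ δ in 𝓝[>] (0 : ℝ), 0 < δ ∧ (δ < a ∧ δ < b) ∧ (a - δ) / (1 + δ) < 1 ∧
      (b - δ) / (1 + δ) < 1 ∧
      (1 - (a - δ) / (1 + δ)) * (1 - (b - δ) / (1 + δ)) < 1 / 2 := by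
    refine eventually_mem_nhdsWithin.and (Eventually.and ?_ (Eventually.and ?_
      (Eventually.and ?_ ?_)))
    · exact nhdsWithin_le_nhds ((eventually_lt_nhds ha0).and (eventually_lt_nhds hb0))
    · exact nhdsWithin_le_nhds ((hcont a).eventually_lt_const (by simpa using ha1))
    · exact nhdsWithin_le_nhds ((hcont b).eventually_lt_const (by simpa using hb1))
    · exact nhdsWithin_le_nhds
        ((((continuousAt_const).sub (hcont a)).mul
          ((continuousAt_const).sub (hcont b))).eventually_lt_const (by simpa using hab))
  obtain ⟨δ, hδ0, ⟨hδa, hδb⟩, hα, hβ, hx⟩ := hex.exists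
  set x := (1 - (a - δ) / (1 + δ)) * (1 - (b - δ) / (1 + δ)) with hxdef
  have hx0 : 0 < x := mul_pos (sub_pos.2 hα) (sub_pos.2 hβ)
  have hr : 2 * x < 1 := by linarith
  set t : ℕ → ℕ → ℝ := fun k l => (l.choose (p k) : ℝ) * l.choose (q k) / 2 ^ (l + 1) with ht
  have ht0 : ∀ k l, 0 ≤ t k l := fun k l => by positivity
  have hts : ∀ k, Summable (t k) := fun k => summable_choose_mul_choose_div _ _
  have htp : ∀ k, 0 < ∑' l, t k l := fun k => tsum_choose_mul_choose_div_pos _ _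
  have hnonneg : ∀ k, 0 ≤ ∑ l ∈ Finset.range (n k), t k l := fun k =>
    Finset.sum_nonneg fun l _ => ht0 k l
  refine tendsto_zero_of_mul_le hn hδ0 (sub_pos.2 hr)
    (Eventually.of_forall fun k => div_nonneg (hnonneg k) (htp k).le) ?_
  filter_upwards [eventually_mul_le_of_tendsto_div hn hp (sub_lt_self a hδ0),
    eventually_mul_le_of_tendsto_div hn hq (sub_lt_self b hδ0)] with k hpk hqk
  have hnk : (0 : ℝ) ≤ n k := Nat.cast_nonneg _
  have hfloor : n k ≤ ⌊(1 + δ) * n k⌋₊ := by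
    rw [Nat.le_floor_iff (by positivity)]
    nlinarith
  have hhead := head_le_of_ratio_ge (ht0 k) (hts k) (by linarith) hr hfloor fun l hl =>
    choose_ratio_ge hδ0 hα hβ hpk hqk (by linarith) (by linarith) hxdef
      ((Nat.le_floor_iff (by positivity)).1 hl)
  have hN : δ * n k - 1 ≤ (⌊(1 + δ) * n k⌋₊ : ℝ) - n k := by
    have := Nat.sub_one_lt_floor ((1 + δ) * (n k : ℝ))
    linarith
  rw [mul_div_assoc', div_le_one (htp k)]
  refine le_trans ?_ hhead
  gcongr

end Limits

/-! ### From dent positions to binomial indices, and the conclusion. -/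

theorem tendsto_pred_div {a : ℝ} (ha0 : 0 < a) {n i : ℕ → ℕ} (hn : Tendsto n atTop atTop)
    (hi : Tendsto (fun k => (i k : ℝ) / (n k : ℝ)) atTop (𝓝 a)) :
    Tendsto (fun k => ((i k - 1 : ℕ) : ℝ) / (n k : ℝ)) atTop (𝓝 a) := by
  have h1 : Tendsto (fun k => (1 : ℝ) / (n k : ℝ)) atTop (𝓝 0) :=
    tendsto_const_nhds.div_atTop (tendsto_natCast_atTop_atTop.comp hn)
  have h2 := hi.sub h1
  rw [sub_zero] at h2
  refine h2.congr' ?_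
  -- As `a > 0`, eventually `i k ≥ 1` and the truncated subtraction is a true one.
  filter_upwards [hi.eventually_const_lt ha0] with k hk
  have hik : 1 ≤ i k := by
    rw [Nat.one_le_iff_ne_zero]
    rintro h
    rw [h] at hk
    simp at hk
  rw [Nat.cast_sub hik, Nat.cast_one, sub_div]

theorem eventually_dent_index {a : ℝ} (ha0 : 0 < a) (ha1 : a < 1) {n i : ℕ → ℕ}
    (hn : Tendsto n atTop atTop)
    (hi : Tendsto (fun k => (i k : ℝ) / (n k : ℝ)) atTop (𝓝 a)) :
    ∀ᶠ k in atTop, 1 ≤ i k ∧ i k ≤ n k := by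
  filter_upwards [hi.eventually_const_lt ha0, eventually_le_mul_of_tendsto_div hn hi ha1]
    with k hk hk'
  refine ⟨?_, by rw [one_mul] at hk'; exact_mod_cast hk'⟩
  rw [Nat.one_le_iff_ne_zero]
  rintro h
  rw [h] at hk
  simp at hk

theorem numDominoTilings_dented_div (n i j : ℕ) (hi : 1 ≤ i) (hin : i ≤ n) (hj : 1 ≤ j)
    (hjn : j ≤ n) :
    (numDominoTilings (dentedAztecDiamond n i j) : ℝ) /
        ((numDominoTilings (aztecDiamond n) : ℝ) * (delannoy (i - 1) (j - 1) : ℝ)) =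
      (∑ l ∈ Finset.range n, (l.choose (i - 1) : ℝ) * l.choose (j - 1) / 2 ^ (l + 1)) /
        ∑' l : ℕ, (l.choose (i - 1) : ℝ) * l.choose (j - 1) / 2 ^ (l + 1) := by
  have hpos : (numDominoTilings (aztecDiamond n) : ℝ) ≠ 0 := by
    exact_mod_cast (numDominoTilings_aztecDiamond_pos n).ne'
  rw [numDominoTilings_dentedAztecDiamond n i j hi hin hj hjn, tsum_choose_mul_choose_div,
    mul_div_mul_left _ _ hpos]

theorem theorem2p2 (a b : ℝ) (ha0 : 0 < a) (ha1 : a < 1) (hb0 : 0 < b) (hb1 : b < 1)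
    (n i j : ℕ → ℕ) (hn : Tendsto n atTop atTop)
    (hi : Tendsto (fun k => (i k : ℝ) / (n k : ℝ)) atTop (𝓝 a))
    (hj : Tendsto (fun k => (j k : ℝ) / (n k : ℝ)) atTop (𝓝 b)) :
    (SegmentOutsideCircle a b ↔ (1 - a) * (1 - b) > 1 / 2) ∧
    (SegmentOutsideCircle a b →
      Tendsto (fun k => (numDominoTilings (dentedAztecDiamond (n k) (i k) (j k)) : ℝ) /
        ((numDominoTilings (aztecDiamond (n k)) : ℝ) * (delannoy (i k - 1) (j k - 1) : ℝ)))
        atTop (𝓝 1)) ∧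
    (SegmentCrossesCircle a b →
      Tendsto (fun k => (numDominoTilings (dentedAztecDiamond (n k) (i k) (j k)) : ℝ) /
        ((numDominoTilings (aztecDiamond (n k)) : ℝ) * (delannoy (i k - 1) (j k - 1) : ℝ)))
        atTop (𝓝 0)) := by
  have hout := segmentOutsideCircle_iff a b ha0 ha1 hb0 hb1
  have hp := tendsto_pred_div ha0 hn hi
  have hq := tendsto_pred_div hb0 hn hj
  have heq : ∀ᶠ k in atTop, (∑ l ∈ Finset.range (n k),
        (l.choose (i k - 1) : ℝ) * l.choose (j k - 1) / 2 ^ (l + 1)) /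
        ∑' l : ℕ, (l.choose (i k - 1) : ℝ) * l.choose (j k - 1) / 2 ^ (l + 1) =
      (numDominoTilings (dentedAztecDiamond (n k) (i k) (j k)) : ℝ) /
        ((numDominoTilings (aztecDiamond (n k)) : ℝ) * (delannoy (i k - 1) (j k - 1) : ℝ)) := by
    filter_upwards [eventually_dent_index ha0 ha1 hn hi, eventually_dent_index hb0 hb1 hn hj]
      with k h1 h2
    exact (numDominoTilings_dented_div _ _ _ h1.1 h1.2 h2.1 h2.2).symm
  refine ⟨hout, fun h => ?_, fun h => ?_⟩
  · exact (tendsto_partial_sum_div_tsum_one ha0 ha1 hb0 hb1 (hout.1 h) hn hp hq).congr' heq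
  · exact (tendsto_partial_sum_div_tsum_zero ha0 ha1 hb0 hb1 (h.lt_half ha0 hb0) hn hp hq).congr'
      heq
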